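/- \textbf{Setting.} Let $d\ge 2$, let $K$ be a finite geometric simplicial complex in $\mathbb R^d$ with vertex set $V$, $n_0$ vertices, $n$ simplices and dimension $\kappa$. For a direction $s\in\mathbb S^{d-1}$ the height of a simplex is $h_s(\sigma)=\max_{v\in\sigma} s\cdot v$ (maximum over vertices). $V$ is in \emph{general position} if every set of at most $d+1$ vertices is affinely independent, no three vertices have collinear projections to the $(e_1,e_2)$-plane, and the vertices have pairwise distinct heights in direction $e_1$. \textbf{Transforms.} A transform $T$ assigns to each finite complex $L\subset\mathbb R^d$ and each $s\in\mathbb S^{d-1}$ a descriptor $T(L,s)$. It is \emph{dimension-returning} if the multiset of pairs $(h_s(\sigma),\dim\sigma)$, $\sigma\in L$, is a function of $T(L,s)$. For the Betti Curve Transform the descriptor is the family, over all $k$, of augmented Betti curves (homology over a field): given an enumeration $\sigma_1,\dots,\sigma_m$ of $L$ along which $h_s$ does not decrease and faces precede cofaces, with $F_i=\{\sigma_1,\dots,\sigma_i\}$, the $k$-th augmented Betti curve is the function $p\mapsto\beta_k(h_s^{-1}(-\infty,p])$ together with the multiset of points $(h_s(\sigma_i),\beta_k(F_i))$ over all $i$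 with $\beta_k(F_i)\ne\beta_k(F_{i-1})$. \textbf{Algorithm.} The following procedure has access to $K$ only by querying directions $s$; the answer to $s$ is the multiset of pairs $(h_s(\sigma),\dim\sigma)$. The \emph{tilt} of $s$ towards $s'$ is the normalization of $(1-\varepsilon)s+\varepsilon s'$, where $2\varepsilon$ is the smallest positive first coordinate of an intersection of two distinct segments from $(0,a)$ to $(1,a')$, with $a$, $a'$ vertex heights in directions $s$, $s'$ (and $\varepsilon=1/4$ if there is no such intersection). (1) \emph{Vertices:} query $e_1$ and, for $i=2,\dots,d$, query $e_i$ and the tilt of $e_1$ towards $e_i$; compute the $i$-th coordinates of the vertices, listed by height in direction $e_1$, from the sorted heights in the directions $e_1$ and the tilt. (2) \emph{Edges:} query $-e_1$. Process the vertices $v$ by increasing first coordinate; find the neighbors of $v$ with larger first coordinate by binary search: list the candidates radially around $v$ in the $(e_1,e_2)$-plane, and, as long as an interval of at least two candidates contains a neighbor, split it in half by a direction $s$ in the $(e_1,e_2)$-plane for which the first half lies below $v$, the second half above $v$ and no other vertex at the height of $v$, query $s$ and $-s$ to count the neighbors in both halves, and continue with the first half and then the second. (3) \emph{Higher simplices:}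 for $k=2,\dots,\kappa$, each $(k-1)$-simplex $\sigma$ and each vertex $v\notin\sigma$, choose $s_1,s_2$ orthogonal to $\mathrm{aff}(\sigma\cup\{v\})$, where in direction $s_2$ no other vertex is at the height of $\sigma\cup\{v\}$, and $s_3$ orthogonal to $\mathrm{aff}(\sigma)$ with $v$ above $\sigma$; let $s_*$ be the tilt of $s_1$ towards $s_2$, $s_L$ the tilt of $s_*$ towards $s_3$, and $s_U$ the negative of the tilt of $-s_*$ towards $s_3$. Accept $\sigma\cup\{v\}$ as a $k$-simplex iff the $k$-indegrees of $\sigma$ in directions $s_U$ and $s_L$ differ by one. Here the $k$-indegree of $\sigma$ in direction $s$ is computed by querying $s$, counting the $k$-simplices at the height of $\sigma$ and subtracting the values of all proper faces $\tau\prec\sigma$; the value of $\tau$ is computed in the same way in the tilt of $s$ towards a direction orthogonal to $\mathrm{aff}(\tau)$ in which all vertices of $\sigma\setminus\tau$ are above $\tau$, each value being computed once. \textbf{Claim.} There is an absolute constant $C$ such that the following holds for all $d\ge2$ and for any choice function on nonempty sets of directions by which the directions left open in the algorithm are selected from the sets of admissible ones. Let $K$ have $\kappa<d$ and vertices in general position,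 and let $S$ be the list of all directions queried by the algorithm on $K$. Then $|S|\le C\,(d+2^{\kappa}\,n\,n_0)$, and $S$ is a faithful discretization for $K$ of the Betti Curve Transform, over any field, and of every dimension-returning transform: if $K'\subset\mathbb R^d$ is any finite geometric simplicial complex having in every direction $s\in S$ the same augmented Betti curves as $K$ (for some choice of the enumerations), or satisfying $T(K',s)=T(K,s)$ for all $s\in S$ for some dimension-returning transform $T$, then $K'=K$. -/

import Mathlib

noncomputable section

open scoped Classical

namespace DirectionalTransform

/-! ### Geometric simplicial complexes, directions and heights -/

/-- Euclidean space `ℝ^d`. -/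
abbrev E (d : ℕ) : Type := EuclideanSpace ℝ (Fin d)

/-- Directions: points of the unit sphere of `ℝ^d`. -/
abbrev Dir (d : ℕ) : Type := Metric.sphere (0 : E d) 1

/-- Finite geometric simplicial complexes in `ℝ^d`; a simplex is given by its set of vertices. -/
abbrev Complex (d : ℕ) : Type := {K : Geometry.SimplicialComplex ℝ (E d) // K.faces.Finite}

variable {d : ℕ}

/-- The finite set of all simplices of `K`. -/
def Complex.simplices (K : Complex d) : Finset (Finset (E d)) := K.2.toFinset

/-- The vertex set of `K`. -/
def Complex.verts (K : Complex d) : Finset (E d) := K.simplices.biUnion id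

/-- The dimension of `K`: the largest dimension of one of its simplices
(`0` if there are none). -/
def Complex.dim (K : Complex d) : ℕ := K.simplices.sup fun σ => σ.card - 1

/-- The height `⟨s, v⟩` of a point in the direction `s`. -/
def vheight (s : Dir d) (v : E d) : ℝ := inner ℝ (s : E d) v

/-- The lower-star filter function: a simplex has the height of its highest vertex. -/
def height (s : Dir d) (σ : Finset (E d)) : ℝ :=
  if h : σ.Nonempty then σ.sup' h (vheight s) else 0

/-- General position of a finite vertex set in `ℝ^d`, `d ≥ 2` (with coordinates indexed from `0`):
every at most `d + 1` vertices are affinely independent, no three distinct vertices have collinear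
projections to the plane of the first two coordinates, and the first coordinates of the vertices
are pairwise distinct. -/
structure GeneralPosition [NeZero d] (V : Finset (E d)) : Prop where
  affineIndependent : ∀ A ⊆ V, A.card ≤ d + 1 → AffineIndependent ℝ ((↑) : A → E d)
  not_collinear : ∀ u ∈ V, ∀ v ∈ V, ∀ w ∈ V, u ≠ v → u ≠ w → v ≠ w →
    ¬ Collinear ℝ ({!₂[u 0, u 1], !₂[v 0, v 1], !₂[w 0, w 1]} : Set (EuclideanSpace ℝ (Fin 2)))
  injective : ∀ u ∈ V, ∀ v ∈ V, u 0 = v 0 → u = v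

/-! ### Dimension-returning transforms -/

/-- The multiset of pairs (height, dimension) of the simplices of `K` in the direction `s`. -/
def heightsDims (K : Complex d) (s : Dir d) : Multiset (ℝ × ℕ) :=
  K.simplices.val.map fun σ => (height s σ, σ.card - 1)

/-- A transform `T` assigns to `K` a family of descriptors `T K s`, one for each direction `s`.
It is dimension-returning if each descriptor `T K s` contains the heights and dimensions of the
simplices of `K` in the direction `s`, that is, if these can be read off from it. -/
def IsDimensionReturning {X : Type*} (T : Complex d → Dir d → X) : Prop :=
  ∃ read : X → Multiset (ℝ × ℕ), ∀ K s, read (T K s) = heightsDims K s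

/-! ### Simplicial homology and augmented Betti curves -/

section Homology

variable (F : Type*) [Field F] {V : Type*}

/-- The simplicial boundary map over `F`, on chains on all finite sets of vertices. A simplex is
oriented by a fixed linear order of all vertices; the sign of the facet omitting `v` is `-1` to the
number of vertices that come before `v`. The empty set is not a simplex. -/
def boundary : (Finset V →₀ F) →ₗ[F] (Finset V →₀ F) :=
  Finsupp.linearCombination F fun σ => ∑ v ∈ σ,
    if (σ.erase v).Nonempty then
      Finsupp.single (σ.erase v) ((-1 : F) ^ (σ.filter fun u => WellOrderingRel u v).card)
    else 0

/-- The `k`-chains of the complex with set of simplices `L`. -/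
def chains (L : Set (Finset V)) (k : ℕ) : Submodule F (Finset V →₀ F) :=
  Finsupp.supported F F {σ | σ ∈ L ∧ σ.card = k + 1}

/-- The `k`-cycles. -/
def cycles (L : Set (Finset V)) (k : ℕ) : Submodule F (Finset V →₀ F) :=
  chains F L k ⊓ LinearMap.ker (boundary F)

/-- The `k`-boundaries. -/
def boundaries (L : Set (Finset V)) (k : ℕ) : Submodule F (Finset V →₀ F) :=
  (chains F L (k + 1)).map (boundary F)

/-- The `k`-th Betti number of the finite complex with set of simplices `L`: the dimension of its
homology in degree `k`, that is, of its `k`-cycles modulo the subspace of its `k`-boundaries. -/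
def betti (L : Set (Finset V)) (k : ℕ) : ℕ :=
  Module.finrank F (cycles F L k) - Module.finrank F (boundaries F L k)

end Homology

/-- An index filtration of `K` compatible with the lower-star filter in direction `s`: an
enumeration of all simplices of `K`, without repetition, in which heights do not decrease and
every simplex comes after its proper faces. -/
structure IndexFiltration (K : Complex d) (s : Dir d) where
  order : List (Finset (E d))
  mem_order : ∀ σ, σ ∈ order ↔ σ ∈ K.simplices
  nodup : order.Nodup
  compatible : order.Pairwise fun σ τ => height s σ ≤ height s τ ∧ ¬ τ ⊆ σ

/-- The `k`-th augmented Betti curve: the Betti curve `p ↦ β_k(h_s⁻¹(-∞, p])`, decorated with the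
multiset of all points `(h_s(σ_i), β_k(F_i))`, one for each index `i` at which the `k`-th Betti
number of the index filtration `F` changes. (Several of these can lie over one height; they are the
left end points of the intervals of constancy, including those that have become empty.) -/
def augBettiCurve (F : Type*) [Field F] {K : Complex d} {s : Dir d} (I : IndexFiltration K s)
    (k : ℕ) : (ℝ → ℕ) × Multiset (ℝ × ℕ) :=
  let b : ℕ → ℕ := fun j => betti F {σ | σ ∈ I.order.take j} k
  (fun p => betti F {σ | σ ∈ K.simplices ∧ height s σ ≤ p} k,
    (Finset.univ.filter fun i : Fin I.order.length => b (i + 1) ≠ b i).val.map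
      fun i => (height s (I.order.get i), b (i + 1)))

/-- `K` and `K'` have the same augmented Betti curves, in all dimensions, in the direction `s`
(for some choice of compatible index filtrations). -/
def SameBettiCurves (F : Type*) [Field F] (K K' : Complex d) (s : Dir d) : Prop :=
  ∃ (I : IndexFiltration K s) (I' : IndexFiltration K' s),
    ∀ k, augBettiCurve F I k = augBettiCurve F I' k

/-! ### Programs with access to an oracle -/

/-- A deterministic procedure that adaptively asks questions `q : Q`, receives answers in `A` and
finally returns an element of `R`. -/
inductive Prog (Q A R : Type) : Type
  | done (r : R) : Prog Q A R
  | query (q : Q) (next : A → Prog Q A R) : Prog Q A R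

namespace Prog

variable {Q A R R' : Type}

/-- Sequential composition. -/
protected def bind : Prog Q A R → (R → Prog Q A R') → Prog Q A R'
  | done r, f => f r
  | query q next, f => query q fun a => (next a).bind f

instance : Monad (Prog Q A) where
  pure := done
  bind := Prog.bind

/-- Ask one question and return the answer. -/
def ask (q : Q) : Prog Q A A := query q done

/-- The list of all questions that are asked when the answers are given by `oracle`. -/
def queries (oracle : Q → A) : Prog Q A R → List Q
  | done _ => []
  | query q next => q :: (next (oracle q)).queries oracle

end Prog

/-- A procedure that may ask for the heights and dimensions of the simplices of an unknown complex
in a direction of its choice. -/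
abbrev DirProg (d : ℕ) (R : Type) : Type := Prog (Dir d) (Multiset (ℝ × ℕ)) R

open Prog

/-! ### The reconstruction algorithm -/

/-- The number of `k`-simplices at height `c` according to an answer. -/
def simplexCount (a : Multiset (ℝ × ℕ)) (k : ℕ) (c : ℝ) : ℕ := a.count (c, k)

/-- The vertex heights according to an answer, with multiplicity and in ascending order. -/
def vertexHeights (a : Multiset (ℝ × ℕ)) : List ℝ :=
  ((a.filter fun x => x.2 = 0).map Prod.fst).sort (· ≤ ·)

variable [NeZero d]

/-- The `i`-th standard basis vector, as a direction. -/
def axis (i : Fin d) : Dir d := ⟨EuclideanSpace.single i 1, by simp⟩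

/-- The direction of a nonzero vector. -/
def normalize (x : E d) : Dir d :=
  if h : x = 0 then axis 0 else ⟨(‖x‖⁻¹ : ℝ) • x, by simp [norm_smul, h]⟩

/-- The first coordinates of the intersections, off the initial vertical line, of two different
ones among the segments from `(0, a)` to `(1, a')`, where `a ∈ H` and `a' ∈ H'`. -/
def crossings (H H' : List ℝ) : Set ℝ :=
  {t | 0 < t ∧ t ≤ 1 ∧ ∃ a ∈ H, ∃ b ∈ H, ∃ a' ∈ H', ∃ b' ∈ H',
    a ≠ b ∧ (1 - t) * a + t * a' = (1 - t) * b + t * b'}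

/-- The tilt of `s` towards `s'`, given the lists of vertex heights in both directions: half of the
way from `s` to the first crossing. If there is no crossing (as there is at most one height in
direction `s`), any small amount will do. -/
def tilt (H H' : List ℝ) (s s' : Dir d) : Dir d :=
  let ε : ℝ := if (crossings H H').Nonempty then sInf (crossings H H') / 2 else 1 / 4
  normalize ((1 - ε) • (s : E d) + ε • (s' : E d))

/-- The tilt of `s` towards `s'` for a known vertex set. -/
def tiltV (V : Finset (E d)) (s s' : Dir d) : Dir d :=
  tilt (V.toList.map (vheight s)) (V.toList.map (vheight s')) s s'

/-- The `i`-th coordinates of all vertices, in the order of their first coordinates `H₁`. -/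
def findCoord (H₁ : List ℝ) (i : Fin d) : DirProg d (List ℝ) := do
  let a ← ask (axis i)
  let s := tilt H₁ (vertexHeights a) (axis 0) (axis i)
  let b ← ask s
  let w := (s : E d) 0
  let h := -(s : E d) i
  return List.zipWith (fun x y => (w * x - y) / h) H₁ (vertexHeights b)

/-- Finds the vertices, listed in ascending order of their first coordinates, and the dimension of
the complex. -/
def findVerts : DirProg d (List (E d) × ℕ) := do
  let a ← ask (axis 0)
  let H₁ := vertexHeights a
  let cols ← (List.finRange d).mapM fun i => if i = 0 then return H₁ else findCoord H₁ i
  let V := (List.range H₁.length).map fun j =>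
    (WithLp.toLp 2 fun i : Fin d => (cols.getD i []).getD j 0 : E d)
  return (V, (a.map Prod.snd).sup)

/-- The vertices of `V` that are above `v` (in the direction of the first basis vector), in
clockwise order around `v` in the plane of the first two coordinates, that is, by increasing slope
of the second coordinate over the first. -/
def radialAbove (V : Finset (E d)) (v : E d) : List (E d) :=
  (V.filter fun u => v 0 < u 0).toList.mergeSort fun u u' =>
    decide ((u 1 - v 1) / (u 0 - v 0) ≤ (u' 1 - v 1) / (u' 0 - v 0))

/-- Directions in the plane of the first two basis vectors for which the vertices of `left` are
below `v`, those of `right` are above `v`, and no vertex other than `v` is at the height of `v`. -/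
def splitDirs (V : Finset (E d)) (v : E d) (left right : List (E d)) : Set (Dir d) :=
  {s | (∀ i : Fin d, 2 ≤ i.val → (s : E d) i = 0) ∧
    (∀ u ∈ left, vheight s u < vheight s v) ∧ (∀ u ∈ right, vheight s v < vheight s u) ∧
    ∀ u ∈ V, u ≠ v → vheight s u ≠ vheight s v}

/-- Binary search for the neighbors of `v` in an interval of radially ordered vertices above `v`.
Here `count` is the number of neighbors of `v` in the interval, `pending` is their number in later
intervals, which are still to be processed, and `known` consists of all neighbors of `v` that are
below `v` or in earlier intervals. Returns `known` with the neighbors in the interval added.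
The choices of directions are made by `pick`. -/
def searchInterval (pick : Set (Dir d) → Dir d) (V : Finset (E d)) (v : E d)
    (interval : List (E d)) (count pending : ℤ) (known : Finset (E d)) :
    DirProg d (Finset (E d)) :=
  if count = 0 then return known
  else if _h : interval.length ≤ 1 then return known ∪ interval.toFinset
  else do
    let left := interval.take (interval.length / 2)
    let right := interval.drop (interval.length / 2)
    let s := pick (splitDirs V v left right)
    let a ← ask s
    let b ← ask (-s)
    let countL : ℤ := simplexCount a 1 (vheight s v) -
      (known.filter fun u => vheight s u < vheight s v).card
    let countR : ℤ := simplexCount b 1 (vheight (-s) v) -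
      (known.filter fun u => vheight (-s) u < vheight (-s) v).card - pending
    let known' ← searchInterval pick V v left countL (pending + countR) known
    searchInterval pick V v right countR pending known'
  termination_by interval.length
  decreasing_by
    · simp only [List.length_take]
      omega
    · simp only [List.length_drop]
      omega

/-- Finds all edges, given the list of vertices in ascending order of their first coordinates. -/
def findEdges (pick : Set (Dir d) → Dir d) (verts : List (E d)) :
    DirProg d (Finset (Finset (E d))) := do
  let V := verts.toFinset
  let a ← ask (-axis 0)
  verts.foldlM (fun edges v => do
    let known ← searchInterval pick V v (radialAbove V v)
      (simplexCount a 1 (vheight (-axis 0) v)) 0 (V.filter fun u => u ≠ v ∧ {u, v} ∈ edges)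
    return edges ∪ known.image fun u => {u, v}) ∅

/-- Directions in which all points of `P` have the same height. -/
def perpDirs (P : Finset (E d)) : Set (Dir d) :=
  {s | ∀ u ∈ P, ∀ v ∈ P, vheight s u = vheight s v}

/-- Directions orthogonal to the affine hull of `P` in which all points of `P` are lower than all
points of `R`. -/
def belowDirs (P R : Finset (E d)) : Set (Dir d) :=
  {s | s ∈ perpDirs P ∧ ∀ w ∈ P, ∀ x ∈ R, vheight s w < vheight s x}

/-- Directions orthogonal to the affine hull of `P` in which no other vertex is at the height
of `P`. -/
def isolatingDirs (V P : Finset (E d)) : Set (Dir d) :=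
  {s | s ∈ perpDirs P ∧ ∀ u ∈ P, ∀ q ∈ V, q ∉ P → vheight s u ≠ vheight s q}

/-- The proper faces of `σ`, in non-descending order of dimension. -/
def properFaces (σ : Finset (E d)) : List (Finset (E d)) :=
  (List.range' 1 (σ.card - 1)).flatMap fun j => (σ.powersetCard j).toList

/-- Computes the `k`-indegree of `σ` in the direction `s`, that is, the number of `k`-dimensional
cofaces of `σ` at the height of `σ`: the number of all `k`-simplices at this height, minus those
that meet `σ` only in a proper face `τ`. The latter numbers are computed recursively and kept in a
table; for `τ`, the direction `s` is tilted so that the vertices in `σ \ τ` move above `τ`. -/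
def indegree (pick : Set (Dir d) → Dir d) (V σ : Finset (E d)) (s : Dir d) (k : ℕ) :
    DirProg d ℤ := do
  let a ← ask s
  let table : Finset (E d) → ℤ ← (properFaces σ).foldlM (fun table τ => do
    let t := tiltV V s (pick (belowDirs τ (σ \ τ)))
    let b ← ask t
    return Function.update table τ
      ((simplexCount b k (height t τ) : ℤ) - ((properFaces τ).map table).sum)) (fun _ => 0)
  return (simplexCount a k (height s σ) : ℤ) - ((properFaces σ).map table).sum

/-- Decides whether the simplex `σ` and the vertex `v ∉ σ` span a simplex, by comparing the
indegrees of `σ` in two directions that bound a wedge at `σ` containing no other vertex than `v`. -/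
def isSimplex (pick : Set (Dir d) → Dir d) (V σ : Finset (E d)) (v : E d) : DirProg d Bool := do
  let s₁ := pick (perpDirs (insert v σ))
  let s₂ := pick (isolatingDirs V (insert v σ))
  let s := tiltV V s₁ s₂
  let s₃ := pick (belowDirs σ {v})
  let lower := tiltV V s s₃
  let upper := -tiltV V (-s) s₃
  let m ← indegree pick V σ upper σ.card
  let n ← indegree pick V σ lower σ.card
  return decide (|m - n| = 1)

/-- All simplices with one vertex more than those in `prev`, the set of all simplices of some
dimension. -/
def nextSkeleton (pick : Set (Dir d) → Dir d) (V : Finset (E d))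
    (prev : Finset (Finset (E d))) : DirProg d (Finset (Finset (E d))) :=
  (prev.toList.flatMap fun σ => (V \ σ).toList.map fun v => (σ, v)).foldlM (fun acc x => do
    let b ← isSimplex pick V x.1 x.2
    return if b then insert (insert x.2 x.1) acc else acc) ∅

/-- The full reconstruction algorithm: it finds the vertices, the edges, and then the simplices of
the dimensions `2, …, κ`, and returns the set of all simplices. It knows the complex only through
the answers to its queries. -/
def reconstruct (pick : Set (Dir d) → Dir d) : DirProg d (Finset (Finset (E d))) := do
  let (verts, κ) ← findVerts
  let V := verts.toFinset
  let edges ← findEdges pick verts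
  let result ← (List.range' 2 (κ - 1)).foldlM (fun x _ => do
    let next ← nextSkeleton pick V x.2
    return (x.1 ∪ next, next)) (V.image (fun v => {v}) ∪ edges, edges)
  return result.1

end DirectionalTransform

end

/-! The algorithm is a deterministic program that sees a complex only through the answers to its
queries. If `K'` gives the answers of `K` to all questions asked on `K`, then the run on `K'` is the
same run and returns the same value (`result_congr`). Faithfulness thus reduces to correctness
(`reconstruct_result`), provided that `K'` also meets the hypotheses of correctness. These are read
off from the answers: the heights in direction `e₁` show that the vertices of `K'` have distinct
first coordinates, the vertex stage needs no more than this, so `K'` has the vertices of `K`, and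
with them general position; the dimension is visible as well (`verts_eq_of_answers`,
`eq_of_answers`).

Correctness rests on the tilt: it keeps every strict height comparison of `s` and breaks ties of `s`
as `s'` does (`tilt_spec`). For vertices, sorted heights in `e₁` and in a tilt of it therefore
belong to the same points, and coordinates follow from a linear equation. For edges, if `v` is alone
at its height, the edges at that height lead to the neighbors below `v`; subtracting known ones
gives the counts that drive the binary search (`searchInterval_result`). For higher simplices, the
`k`-simplices at the height of `σ` are sorted by their intersection `τ` with `σ`, and the part of a
proper face `τ` is the indegree of `τ` in a tilt that lifts `σ \ τ` (`simplexCount_eq_sum`,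
`lowerCofaces_tiltV`). Finally, the directions `upper` and `lower` differ near `σ` only in the side
on which `v` lies, so the two indegrees differ exactly by the candidate `insert v σ`
(`isSimplex_result`).

Augmented Betti curves carry the same information as heights and dimensions. A new simplex of
dimension `m` either raises `β_m` by one or lowers `β_(m-1)` by one (`betti_insert`). The
`k`-simplices up to height `p` are thus the rises of `β_k` plus the falls of `β_(k-1)`. The
decoration counts all changes, the curve gives their sum, and half of the sum or difference of these
separates rises from falls (`two_mul_card_filter`). -/

noncomputable section

open scoped Classical

namespace DirectionalTransform

/-! ### Running programs -/

namespace Prog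

variable {Q A R R' S : Type}

/-- The value returned by a program whose questions are answered by `oracle`. -/
def result (oracle : Q → A) : Prog Q A R → R
  | done r => r
  | query q next => (next (oracle q)).result oracle

theorem bind_eq (p : Prog Q A R) (f : R → Prog Q A R') : p >>= f = p.bind f := rfl

theorem bind_done (p : Prog Q A R) : p.bind done = p := by
  induction p with
  | done r => rfl
  | query q next ih => exact congrArg (query q) (funext ih)

theorem bind_assoc' (p : Prog Q A R) (f : R → Prog Q A R') (g : R' → Prog Q A S) :
    (p.bind f).bind g = p.bind fun x => (f x).bind g := by
  induction p with
  | done r => rfl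
  | query q next ih => exact congrArg (query q) (funext ih)

/-- Lawfulness allows `<$>` and `mapM` to be unfolded into binds below. -/
instance : LawfulMonad (Prog Q A) :=
  LawfulMonad.mk' (Prog Q A) (id_map := fun x => bind_done x) (pure_bind := fun _ _ => rfl)
    (bind_assoc := bind_assoc')

variable (o : Q → A)

@[simp] theorem result_pure (r : R) : (pure r : Prog Q A R).result o = r := rfl

@[simp] theorem result_ask (q : Q) : (ask q : Prog Q A A).result o = o q := rfl

@[simp] theorem result_bind (p : Prog Q A R) (f : R → Prog Q A R') :
    (p >>= f).result o = (f (p.result o)).result o := by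
  rw [bind_eq]
  induction p with
  | done r => rfl
  | query q next ih => exact ih _

@[simp] theorem queries_pure (r : R) : (pure r : Prog Q A R).queries o = [] := rfl

@[simp] theorem queries_ask (q : Q) : (ask q : Prog Q A A).queries o = [q] := rfl

@[simp] theorem queries_bind (p : Prog Q A R) (f : R → Prog Q A R') :
    (p >>= f).queries o = p.queries o ++ (f (p.result o)).queries o := by
  rw [bind_eq]
  induction p with
  | done r => rfl
  | query q next ih => exact congrArg (List.cons q) (ih _)

/-- Each question depends on earlier answers only, so agreement along one run forces the other run
to coincide with it. This turns correctness into faithfulness. -/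
theorem result_congr {o o' : Q → A} (p : Prog Q A R) (h : ∀ q ∈ p.queries o, o' q = o q) :
    p.result o' = p.result o := by
  induction p with
  | done r => rfl
  | query q next ih =>
    simp only [queries, List.mem_cons, forall_eq_or_imp] at h
    simp only [result]
    rw [h.1, ih _ h.2]

/-- An invariant of the state of a loop holds at the end of the loop. -/
theorem foldlM_invariant {α β : Type} (f : β → α → Prog Q A β) (P : List α → β → Prop)
    (l : List α) (b : β) (h0 : P [] b)
    (step : ∀ pre x post b, l = pre ++ x :: post → P pre b →
      P (pre ++ [x]) ((f b x).result o)) :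
    P l ((l.foldlM f b).result o) := by
  suffices H : ∀ (post pre : List α) (b : β), l = pre ++ post → P pre b →
      P l ((post.foldlM f b).result o) from H l [] b rfl h0
  intro post
  induction post with
  | nil =>
    intro pre b hl hP
    rw [List.append_nil] at hl
    simpa [hl] using hP
  | cons x post ih =>
    intro pre b hl hP
    rw [List.foldlM_cons, result_bind]
    exact ih (pre ++ [x]) _ (by simpa using hl) (step pre x post b hl hP)

/-- The number of queries of a loop, if an invariant bounds those of each round. -/
theorem length_queries_foldlM_le_sum {α β : Type} (f : β → α → Prog Q A β)
    (P : List α → β → Prop) (c : α → ℕ) (l : List α) (b : β) (h0 : P [] b)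
    (step : ∀ pre x post b, l = pre ++ x :: post → P pre b →
      P (pre ++ [x]) ((f b x).result o) ∧ ((f b x).queries o).length ≤ c x) :
    ((l.foldlM f b).queries o).length ≤ (l.map c).sum := by
  suffices H : ∀ (post pre : List α) (b : β), l = pre ++ post → P pre b →
      ((post.foldlM f b).queries o).length ≤ (post.map c).sum from H l [] b rfl h0
  intro post
  induction post with
  | nil => intro pre b hl hP; simp
  | cons x post ih =>
    intro pre b hl hP
    obtain ⟨h1, h2⟩ := step pre x post b hl hP
    rw [List.foldlM_cons, queries_bind, List.length_append, List.map_cons, List.sum_cons]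
    exact Nat.add_le_add h2 (ih (pre ++ [x]) _ (by simpa using hl) h1)

theorem length_queries_foldlM_le {α β : Type} (f : β → α → Prog Q A β) (c : ℕ) (l : List α)
    (b : β) (h : ∀ x ∈ l, ∀ b, ((f b x).queries o).length ≤ c) :
    ((l.foldlM f b).queries o).length ≤ l.length * c := by
  have := length_queries_foldlM_le_sum o f (fun _ _ => True) (fun _ => c) l b trivial
    (fun pre x post b hl _ => ⟨trivial, h x (by simp [hl]) b⟩)
  simpa using this

@[simp] theorem result_map (g : R → R') (p : Prog Q A R) : (g <$> p).result o = g (p.result o) := by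
  rw [map_eq_pure_bind, result_bind, result_pure]

@[simp] theorem queries_map (g : R → R') (p : Prog Q A R) : (g <$> p).queries o = p.queries o := by
  rw [map_eq_pure_bind, queries_bind, queries_pure, List.append_nil]

theorem result_mapM {α β : Type} (f : α → Prog Q A β) (l : List α) :
    (l.mapM f).result o = l.map fun x => (f x).result o := by
  induction l with
  | nil => simp
  | cons x l ih => simp [List.mapM_cons, ih]

theorem queries_mapM {α β : Type} (f : α → Prog Q A β) (l : List α) :
    (l.mapM f).queries o = l.flatMap fun x => (f x).queries o := by
  induction l with
  | nil => simp
  | cons x l ih => simp [List.mapM_cons, ih]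

end Prog

end DirectionalTransform

namespace DirectionalTransform

variable {d : ℕ}

/-! ### Simplices and heights -/

namespace Complex

variable {K : Complex d} {σ τ : Finset (E d)} {v : E d}

theorem mem_simplices : σ ∈ K.simplices ↔ σ ∈ K.1.faces := Set.Finite.mem_toFinset _

theorem nonempty_of_mem (h : σ ∈ K.simplices) : σ.Nonempty :=
  K.1.nonempty_of_mem_faces (mem_simplices.1 h)

theorem mem_of_subset (h : σ ∈ K.simplices) (hτ : τ ⊆ σ) (hne : τ.Nonempty) :
    τ ∈ K.simplices :=
  mem_simplices.2 ((K.1.isRelLowerSet_faces (mem_simplices.1 h)).2 hτ hne)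

theorem subset_verts (h : σ ∈ K.simplices) : σ ⊆ K.verts :=
  fun _ hv => Finset.mem_biUnion.2 ⟨σ, h, hv⟩

theorem mem_verts : v ∈ K.verts ↔ {v} ∈ K.simplices := by
  constructor
  · intro h
    obtain ⟨σ, hσ, hv⟩ := Finset.mem_biUnion.1 h
    exact mem_of_subset hσ (by simpa using hv) (by simp)
  · intro h
    exact subset_verts h (by simp)

theorem card_le_dim (h : σ ∈ K.simplices) : σ.card ≤ K.dim + 1 := by
  have := Finset.le_sup (f := fun σ : Finset (E d) => σ.card - 1) h
  have h2 : σ.card - 1 ≤ K.dim := this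
  omega

theorem ext_simplices {K K' : Complex d} (h : K.simplices = K'.simplices) : K = K' := by
  apply Subtype.ext
  apply Geometry.SimplicialComplex.ext
  ext σ
  rw [← mem_simplices, ← mem_simplices, h]

theorem card_verts_le : K.verts.card ≤ K.simplices.card := by
  refine Finset.card_le_card_of_injOn (fun v => {v}) ?_ ?_
  · intro v hv
    exact mem_verts.1 hv
  · intro u _ v _ h
    exact Finset.singleton_injective h

end Complex

theorem vheight_sub (s : Dir d) (u v : E d) :
    vheight s u - vheight s v = inner ℝ (s : E d) (u - v) := (inner_sub_right _ _ _).symm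

@[simp] theorem vheight_neg (s : Dir d) (v : E d) : vheight (-s) v = -vheight s v := by
  simp [vheight]

theorem height_eq_iff {s : Dir d} {σ : Finset (E d)} (h : σ.Nonempty) {c : ℝ} :
    height s σ = c ↔ (∃ u ∈ σ, vheight s u = c) ∧ ∀ u ∈ σ, vheight s u ≤ c := by
  rw [height, dif_pos h]
  constructor
  · rintro rfl
    obtain ⟨u, hu, hs⟩ := Finset.exists_mem_eq_sup' h (vheight s)
    exact ⟨⟨u, hu, hs.symm⟩, fun w hw => Finset.le_sup' _ hw⟩
  · rintro ⟨⟨u, hu, rfl⟩, h2⟩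
    exact le_antisymm (Finset.sup'_le _ _ h2) (Finset.le_sup' _ hu)

theorem height_singleton (s : Dir d) (v : E d) : height s {v} = vheight s v := by
  simp [height]

theorem height_of_perp {s : Dir d} {σ : Finset (E d)} (h : s ∈ perpDirs σ) {u : E d}
    (hu : u ∈ σ) : height s σ = vheight s u :=
  (height_eq_iff ⟨u, hu⟩).2 ⟨⟨u, hu, rfl⟩, fun w hw => (h w hw u hu).le⟩

theorem simplexCount_heightsDims (K : Complex d) (s : Dir d) (k : ℕ) (c : ℝ) :
    simplexCount (heightsDims K s) k c =
      (K.simplices.filter fun ρ => ρ.card = k + 1 ∧ height s ρ = c).card := by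
  rw [simplexCount, heightsDims, Multiset.count_map, Finset.card_def, Finset.filter_val]
  congr 1
  apply Multiset.filter_congr
  intro ρ hρ
  -- The recorded dimension is a truncated `card - 1`, so nonemptiness is needed to recover the
  -- cardinality.
  have := (Complex.nonempty_of_mem (K := K) hρ).card_pos
  simp only [Prod.mk.injEq]
  constructor
  · rintro ⟨h1, h2⟩
    exact ⟨by omega, h1.symm⟩
  · rintro ⟨h1, h2⟩
    exact ⟨h2.symm, by omega⟩

/-! ### Tilting -/

section Tilt

variable [NeZero d]

theorem coe_normalize {x : E d} (h : x ≠ 0) : (normalize x : E d) = ‖x‖⁻¹ • x := by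
  rw [normalize, dif_neg h]

theorem vheight_normalize {x : E d} (h : x ≠ 0) (v : E d) :
    vheight (normalize x) v = ‖x‖⁻¹ * inner ℝ x v := by
  rw [vheight, coe_normalize h, real_inner_smul_left]

theorem vheight_normalize_lt {x : E d} (h : x ≠ 0) (u v : E d) :
    vheight (normalize x) u < vheight (normalize x) v ↔ inner ℝ x u < inner ℝ x v := by
  rw [vheight_normalize h, vheight_normalize h]
  exact mul_lt_mul_iff_right₀ (inv_pos.2 (norm_pos_iff.2 h))

theorem vheight_normalize_eq {x : E d} (h : x ≠ 0) (u v : E d) :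
    vheight (normalize x) u = vheight (normalize x) v ↔ inner ℝ x u = inner ℝ x v := by
  rw [vheight_normalize h, vheight_normalize h]
  exact mul_right_inj' (inv_ne_zero (norm_ne_zero_iff.2 h))

/-- Segments with different starting heights meet at most once, at a parameter computed from the
four end heights. Finiteness makes the infimum in `tilt` an actual crossing, hence positive. -/
theorem crossings_finite (H H' : List ℝ) : (crossings H H').Finite := by
  have hf : (Set.image (fun p : (ℝ × ℝ) × (ℝ × ℝ) =>
      (p.1.1 - p.1.2) / ((p.1.1 - p.1.2) - (p.2.1 - p.2.2)))
      (({a | a ∈ H} ×ˢ {a | a ∈ H}) ×ˢ ({a | a ∈ H'} ×ˢ {a | a ∈ H'}))).Finite :=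
    (((List.finite_toSet H).prod (List.finite_toSet H)).prod
      ((List.finite_toSet H').prod (List.finite_toSet H'))).image _
  refine hf.subset ?_
  rintro t ⟨ht0, ht1, a, ha, b, hb, a', ha', b', hb', hab, h⟩
  refine ⟨((a, b), (a', b')), ⟨⟨ha, hb⟩, ⟨ha', hb'⟩⟩, ?_⟩
  have key : ((a - b) - (a' - b')) * t = a - b := by linear_combination -h
  have hne : (a - b) - (a' - b') ≠ 0 := by
    intro h0
    rw [h0, zero_mul] at key
    exact hab (sub_eq_zero.1 key.symm)
  exact (div_eq_iff hne).2 (by linear_combination -key)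

/-- The tilt is a positive multiple of a proper convex combination, and it keeps the strict order
of the heights of the vertices. -/
theorem tilt_spec {V : Finset (E d)} {H H' : List ℝ} {s s' : Dir d}
    (hH : ∀ a, a ∈ H ↔ ∃ v ∈ V, vheight s v = a) (hH' : ∀ a, a ∈ H' ↔ ∃ v ∈ V, vheight s' v = a) :
    ∃ ε c : ℝ, 0 < ε ∧ 0 < c ∧
      (tilt H H' s s' : E d) = c • ((1 - ε) • (s : E d) + ε • (s' : E d)) ∧
      ∀ u ∈ V, ∀ v ∈ V, vheight s u < vheight s v →
        vheight (tilt H H' s s') u < vheight (tilt H H' s s') v := by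
  set X := crossings H H' with hX
  set ε : ℝ := if X.Nonempty then sInf X / 2 else 1 / 4 with hε
  have hmem : X.Nonempty → sInf X ∈ X := fun h => h.csInf_mem (crossings_finite H H')
  have hle : ∀ t ∈ X, sInf X ≤ t := fun t ht => csInf_le (crossings_finite H H').bddBelow ht
  have hε0 : 0 < ε := by
    by_cases h : X.Nonempty
    · rw [hε, if_pos h]; exact half_pos (hmem h).1
    · rw [hε, if_neg h]; norm_num
  have hε1 : ε ≤ 1 / 2 := by
    by_cases h : X.Nonempty
    · rw [hε, if_pos h]; linarith [(hmem h).2.1]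
    · rw [hε, if_neg h]; norm_num
  have hεX : ∀ t ∈ X, ε < t := by
    intro t ht
    rw [hε, if_pos ⟨t, ht⟩]
    linarith [hle t ht, (hmem ⟨t, ht⟩).1]
  have hn : ‖(s : E d)‖ = 1 := norm_eq_of_mem_sphere s
  have hn' : ‖(s' : E d)‖ = 1 := norm_eq_of_mem_sphere s'
  -- The combination of two unit vectors can vanish only if `ε = 1/2` and `s = -s'`. This excludes
  -- the default `1/4`, so there are two distinct heights; their segments run to the negated heights
  -- and cross at `1/2`, although `ε` lies strictly below every crossing.
  have hne : (1 - ε) • (s : E d) + ε • (s' : E d) ≠ 0 := by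
    intro h0
    have h1 : (1 - ε) • (s : E d) = -(ε • (s' : E d)) := eq_neg_of_add_eq_zero_left h0
    have h2 : 1 - ε = ε := by
      have := congrArg norm h1
      rw [norm_neg, norm_smul, norm_smul, hn, hn', Real.norm_of_nonneg (by linarith),
        Real.norm_of_nonneg hε0.le] at this
      linarith
    have h3 : (s : E d) = -(s' : E d) := by
      rw [h2, ← smul_neg] at h1
      exact smul_right_injective _ hε0.ne' h1
    have hhalf : ε = 1 / 2 := by linarith
    have hXne : X.Nonempty := by
      by_contra h
      rw [hε, if_neg h] at hhalf
      norm_num at hhalf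
    obtain ⟨t, -, -, a, ha, b, hb, -, -, -, -, hab, -⟩ := hXne
    obtain ⟨u, hu, rfl⟩ := (hH a).1 ha
    obtain ⟨v, hv, rfl⟩ := (hH b).1 hb
    have hneg : ∀ w, vheight s w = -vheight s' w := fun w => by
      rw [vheight, h3, inner_neg_left]; rfl
    have : (1 / 2 : ℝ) ∈ X := by
      refine ⟨by norm_num, by norm_num, _, ha, _, hb, vheight s' u, (hH' _).2 ⟨u, hu, rfl⟩,
        vheight s' v, (hH' _).2 ⟨v, hv, rfl⟩, hab, ?_⟩
      rw [hneg u, hneg v]; ring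
    linarith [hεX _ this]
  have htilt : tilt H H' s s' = normalize ((1 - ε) • (s : E d) + ε • (s' : E d)) := rfl
  refine ⟨ε, ‖(1 - ε) • (s : E d) + ε • (s' : E d)‖⁻¹, hε0, inv_pos.2 (norm_pos_iff.2 hne),
    by rw [htilt, coe_normalize hne], ?_⟩
  intro u hu v hv huv
  rw [htilt, vheight_normalize_lt hne]
  simp only [inner_add_left, real_inner_smul_left]
  change (1 - ε) * vheight s u + ε * vheight s' u < (1 - ε) * vheight s v + ε * vheight s' v
  -- Had the strict order been lost at `ε`, the segments of `u` and `v` would already have crossed,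
  -- at the parameter `(b - a) / ((b - a) + (a' - b'))`.
  by_contra! hcon
  set a := vheight s u
  set b := vheight s v
  set a' := vheight s' u
  set b' := vheight s' v
  have hden : 0 < (b - a) + (a' - b') := by
    by_contra! h
    nlinarith
  have h1 : (b - a) / ((b - a) + (a' - b')) ≤ ε := by
    rw [div_le_iff₀ hden]; linarith
  have h0 : 0 < (b - a) / ((b - a) + (a' - b')) := div_pos (by linarith) hden
  have hX' : (b - a) / ((b - a) + (a' - b')) ∈ X := by
    refine ⟨h0, by linarith, a, (hH _).2 ⟨u, hu, rfl⟩, b, (hH _).2 ⟨v, hv, rfl⟩, a',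
      (hH' _).2 ⟨u, hu, rfl⟩, b', (hH' _).2 ⟨v, hv, rfl⟩, huv.ne, ?_⟩
    field_simp
    ring
  linarith [hεX _ hX']

variable {V : Finset (E d)} {s s' : Dir d} {u v : E d}

theorem tiltV_lt (hu : u ∈ V) (hv : v ∈ V) (h : vheight s u < vheight s v) :
    vheight (tiltV V s s') u < vheight (tiltV V s s') v := by
  obtain ⟨ε, c, -, -, -, h4⟩ := tilt_spec (V := V) (H := V.toList.map (vheight s))
    (H' := V.toList.map (vheight s')) (s := s) (s' := s') (by simp) (by simp)
  exact h4 u hu v hv h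

/-- This form serves the ties of `s`, where the first summand drops out and only the sign of `b`
matters. Points of `V` that `s` already separates are covered by `tiltV_lt`. -/
theorem exists_tiltV_sub (V : Finset (E d)) (s s' : Dir d) : ∃ a b : ℝ, 0 < b ∧ ∀ u v,
    vheight (tiltV V s s') u - vheight (tiltV V s s') v =
      a * (vheight s u - vheight s v) + b * (vheight s' u - vheight s' v) := by
  obtain ⟨ε, c, h1, h2, h3, -⟩ := tilt_spec (V := V) (H := V.toList.map (vheight s))
    (H' := V.toList.map (vheight s')) (s := s) (s' := s') (by simp) (by simp)
  refine ⟨c * (1 - ε), c * ε, mul_pos h2 h1, fun u v => ?_⟩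
  simp only [vheight_sub]
  change inner ℝ (tilt _ _ s s' : E d) _ = _
  rw [h3]
  simp only [inner_add_left, real_inner_smul_left]
  ring

theorem tiltV_lt_of_eq (h : vheight s u = vheight s v) (h' : vheight s' u < vheight s' v) :
    vheight (tiltV V s s') u < vheight (tiltV V s s') v := by
  obtain ⟨a, b, hb, hab⟩ := exists_tiltV_sub V s s'
  have := hab u v
  rw [h, sub_self, mul_zero, zero_add] at this
  nlinarith

theorem tiltV_eq_of_eq (h : vheight s u = vheight s v) (h' : vheight s' u = vheight s' v) :
    vheight (tiltV V s s') u = vheight (tiltV V s s') v := by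
  obtain ⟨a, b, hb, hab⟩ := exists_tiltV_sub V s s'
  have := hab u v
  rw [h, h', sub_self, sub_self, mul_zero, mul_zero, zero_add] at this
  exact sub_eq_zero.1 this

theorem tiltV_lt_iff (hu : u ∈ V) (hv : v ∈ V) (h : vheight s u ≠ vheight s v) :
    vheight (tiltV V s s') u < vheight (tiltV V s s') v ↔ vheight s u < vheight s v := by
  refine ⟨fun h' => ?_, tiltV_lt hu hv⟩
  rcases h.lt_or_gt with h1 | h1
  · exact h1
  · exact absurd h' (tiltV_lt hv hu h1).not_gt

theorem tiltV_ne (hu : u ∈ V) (hv : v ∈ V) (h : vheight s u ≠ vheight s v) :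
    vheight (tiltV V s s') u ≠ vheight (tiltV V s s') v := by
  rcases h.lt_or_gt with h1 | h1
  · exact (tiltV_lt hu hv h1).ne
  · exact (tiltV_lt hv hu h1).ne'

end Tilt

/-! ### Existence of directions -/

/-- Prescribed height differences on affinely independent points. -/
theorem exists_inner_sub_eq {A : Finset (E d)} (hA : AffineIndependent ℝ ((↑) : A → E d))
    (f : E d → ℝ) :
    ∃ x : E d, ∀ u ∈ A, ∀ w ∈ A, inner ℝ x u - inner ℝ x w = f u - f w := by
  rcases A.eq_empty_or_nonempty with rfl | ⟨p, hp⟩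
  · exact ⟨0, by simp⟩
  -- The differences to `p` are linearly independent, so a functional can be prescribed on them and
  -- extended to the whole space; the Riesz isomorphism turns it into an inner product.
  have hli := (affineIndependent_iff_linearIndependent_vsub ℝ _ (⟨p, hp⟩ : A)).1 hA
  let b := Module.Basis.span hli
  obtain ⟨g, hg⟩ := LinearMap.exists_extend (b.constr ℝ fun i => f (i : A) - f p)
  have hg' : ∀ u ∈ A, g (u - p) = f u - f p := by
    intro u hu
    by_cases h : u = p
    · simp [h]
    · let i : {x : A // x ≠ ⟨p, hp⟩} := ⟨⟨u, hu⟩, fun h' => h (congrArg Subtype.val h')⟩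
      have h1 : ((b i : Submodule.span ℝ _) : E d) = u - p := by
        simp only [b, Module.Basis.span_apply]; rfl
      have h2 := LinearMap.congr_fun hg (b i)
      rw [Module.Basis.constr_basis] at h2
      rw [← h1]
      exact h2
  refine ⟨(InnerProductSpace.toDual ℝ (E d)).symm (LinearMap.toContinuousLinearMap g), ?_⟩
  intro u hu w hw
  rw [InnerProductSpace.toDual_symm_apply, InnerProductSpace.toDual_symm_apply]
  have h1 := hg' u hu
  have h2 := hg' w hw
  rw [map_sub] at h1 h2
  simp only [LinearMap.coe_toContinuousLinearMap']
  linarith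

section Directions

variable [NeZero d]

/-- Affine independence permits height `1` on `R` and `0` on the rest of `A`, up to a common shift.
-/
theorem belowDirs_nonempty {P R A : Finset (E d)} (hA : AffineIndependent ℝ ((↑) : A → E d))
    (hP : P ⊆ A) (hR : R ⊆ A) (hPR : Disjoint P R) (hPne : P.Nonempty) (hRne : R.Nonempty) :
    (belowDirs P R).Nonempty := by
  obtain ⟨x, hx⟩ := exists_inner_sub_eq hA fun u => if u ∈ R then 1 else 0
  have hlt : ∀ w ∈ P, ∀ y ∈ R, inner ℝ x w < inner ℝ x y := by
    intro w hw y hy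
    have := hx y (hR hy) w (hP hw)
    simp only [if_pos hy, if_neg (Finset.disjoint_left.1 hPR hw)] at this
    linarith
  have hne : x ≠ 0 := by
    rintro rfl
    obtain ⟨w, hw⟩ := hPne
    obtain ⟨y, hy⟩ := hRne
    simpa using hlt w hw y hy
  refine ⟨normalize x, fun u hu w hw => (vheight_normalize_eq hne u w).2 ?_,
    fun w hw y hy => (vheight_normalize_lt hne w y).2 (hlt w hw y hy)⟩
  have := hx u (hP hu) w (hP hw)
  simp only [if_neg (Finset.disjoint_left.1 hPR hu), if_neg (Finset.disjoint_left.1 hPR hw)]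
    at this
  linarith

/-- The vectors orthogonal to the differences in `P` form a space `W`, nonzero because `P` has at
most `d` points. Each outside vertex `q` forbids the subspace of `W` that puts `q` at the height of
`P`; it is proper since `insert q P` is affinely independent. Finitely many proper subspaces do not
cover a real vector space. -/
theorem isolatingDirs_nonempty {V P : Finset (E d)} (hP : P.card ≤ d) (hPne : P.Nonempty)
    (hV : ∀ q ∈ V, q ∉ P → AffineIndependent ℝ ((↑) : ↥(insert q P : Finset (E d)) → E d)) :
    (isolatingDirs V P).Nonempty := by
  obtain ⟨p, hp⟩ := hPne
  let U : Submodule ℝ (E d) := Submodule.span ℝ ((P.erase p).image fun u => u - p : Finset (E d))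
  let W : Submodule ℝ (E d) := Uᗮ
  have hWmem : ∀ x ∈ W, ∀ u ∈ P, inner ℝ x u = inner ℝ x p := by
    intro x hx u hu
    by_cases h : u = p
    · rw [h]
    have : u - p ∈ U := Submodule.subset_span (by
      simp only [Finset.coe_image, Set.mem_image, Finset.mem_coe]
      exact ⟨u, Finset.mem_erase.2 ⟨h, hu⟩, rfl⟩)
    have := (Submodule.mem_orthogonal' U x).1 hx _ this
    rw [inner_sub_right] at this
    linarith
  have hWtop : W ≠ ⊥ := by
    intro h
    have hU : U = ⊤ := (Submodule.orthogonal_eq_bot_iff).1 h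
    have h1 : Module.finrank ℝ U ≤ ((P.erase p).image fun u => u - p : Finset (E d)).card :=
      finrank_span_finset_le_card _
    rw [hU, finrank_top, finrank_euclideanSpace_fin] at h1
    have h2 := Finset.card_image_le (s := P.erase p) (f := fun u => u - p)
    rw [Finset.card_erase_of_mem hp] at h2
    have := NeZero.pos d
    omega
  let k : E d → Submodule ℝ W := fun q => LinearMap.ker
    ((innerₛₗ ℝ (q - p)).comp W.subtype)
  have hk : ∀ (q : E d) (x : W), x ∈ k q ↔ inner ℝ (x : E d) q = inner ℝ (x : E d) p := by
    intro q x
    simp only [k, LinearMap.mem_ker, LinearMap.comp_apply, Submodule.subtype_apply,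
      innerₛₗ_apply_apply]
    rw [real_inner_comm, inner_sub_right, sub_eq_zero]
  -- Including `⊥` makes the chosen vector nonzero even if there are no outside vertices.
  let T : Finset (Submodule ℝ W) := insert ⊥ ((V \ P).image k)
  have hT : ⊤ ∉ T := by
    intro h
    rcases Finset.mem_insert.1 h with h | h
    · apply hWtop
      rw [Submodule.eq_bot_iff]
      intro x hx
      have : (⟨x, hx⟩ : W) ∈ (⊥ : Submodule ℝ W) := h ▸ Submodule.mem_top
      simpa using this
    · obtain ⟨q, hq, hqk⟩ := Finset.mem_image.1 h
      obtain ⟨hqV, hqP⟩ := Finset.mem_sdiff.1 hq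
      obtain ⟨x, hx⟩ := exists_inner_sub_eq (hV q hqV hqP) fun u => if u = q then 1 else 0
      have hpq : p ≠ q := fun h => hqP (h ▸ hp)
      have hxW : x ∈ W := by
        rw [Submodule.mem_orthogonal]
        intro y hy
        induction hy using Submodule.span_induction with
        | mem y hy =>
          simp only [Finset.coe_image, Set.mem_image, Finset.mem_coe] at hy
          obtain ⟨u, hu, rfl⟩ := hy
          have huP := Finset.mem_of_mem_erase hu
          have huq : u ≠ q := fun h => hqP (h ▸ huP)
          have := hx u (Finset.mem_insert_of_mem huP) p (Finset.mem_insert_of_mem hp)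
          rw [if_neg huq, if_neg hpq] at this
          rw [real_inner_comm, inner_sub_right]
          linarith
        | zero => simp
        | add y z _ _ h1 h2 => rw [inner_add_left, h1, h2, add_zero]
        | smul a y _ h1 => rw [real_inner_smul_left, h1, mul_zero]
      have h1 : (⟨x, hxW⟩ : W) ∈ k q := hqk ▸ Submodule.mem_top
      rw [hk] at h1
      have := hx q (Finset.mem_insert_self _ _) p (Finset.mem_insert_of_mem hp)
      rw [if_pos rfl, if_neg hpq] at this
      simp only at h1
      linarith
  have hun := Subspace.biUnion_ne_univ_of_top_notMem hT
  obtain ⟨x, hx⟩ := (Set.ne_univ_iff_exists_notMem _).1 hun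
  simp only [Set.mem_iUnion, SetLike.mem_coe, not_exists] at hx
  have hx0 : (x : E d) ≠ 0 := by
    intro h
    exact hx ⊥ (Finset.mem_insert_self _ _) ((Submodule.mem_bot ℝ).2 (Subtype.ext h))
  refine ⟨normalize (x : E d), fun u hu w hw => (vheight_normalize_eq hx0 u w).2 ?_, ?_⟩
  · rw [hWmem x x.2 u hu, hWmem x x.2 w hw]
  · intro u hu q hqV hqP h
    rw [vheight_normalize_eq hx0, hWmem x x.2 u hu] at h
    exact hx (k q) (Finset.mem_insert_of_mem (Finset.mem_image_of_mem k
      (Finset.mem_sdiff.2 ⟨hqV, hqP⟩))) ((hk q x).2 h.symm)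

end Directions

end DirectionalTransform

namespace DirectionalTransform

variable {d : ℕ}

open Prog

/-! ### Reconstruction of the vertices -/

theorem map_vertices (K : Complex d) (s : Dir d) :
    ((heightsDims K s).filter fun x => x.2 = 0).map Prod.fst = K.verts.val.map (vheight s) := by
  have h : (K.simplices.filter fun σ => σ.card - 1 = 0) =
      K.verts.map ⟨fun v => {v}, Finset.singleton_injective⟩ := by
    ext σ
    simp only [Finset.mem_filter, Finset.mem_map, Function.Embedding.coeFn_mk]
    constructor
    · rintro ⟨h1, h2⟩
      have := (Complex.nonempty_of_mem h1).card_pos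
      obtain ⟨v, rfl⟩ := Finset.card_eq_one.1 (show σ.card = 1 by omega)
      exact ⟨v, Complex.mem_verts.2 h1, rfl⟩
    · rintro ⟨v, hv, rfl⟩
      exact ⟨Complex.mem_verts.1 hv, by simp⟩
  rw [heightsDims, Multiset.filter_map, Multiset.map_map]
  have h3 := congrArg (fun t : Finset (Finset (E d)) => t.val.map (height s)) h
  simp only [Finset.filter_val, Finset.map_val, Multiset.map_map] at h3
  refine Eq.trans h3 (Multiset.map_congr rfl fun v _ => ?_)
  exact height_singleton s v

theorem vertexHeights_eq {K : Complex d} {s : Dir d} {L : List (E d)}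
    (hL : (L : Multiset (E d)) = K.verts.val)
    (hs : (L.map (vheight s)).Pairwise (· ≤ ·)) :
    vertexHeights (heightsDims K s) = L.map (vheight s) := by
  rw [vertexHeights, map_vertices, ← hL, Multiset.map_coe]
  refine List.Perm.eq_of_pairwise' (r := (· ≤ ·)) ?_ hs ?_
  · exact Multiset.pairwise_sort _ _
  · rw [← Multiset.coe_eq_coe, Multiset.sort_eq]

theorem mem_vertexHeights {K : Complex d} {s : Dir d} {a : ℝ} :
    a ∈ vertexHeights (heightsDims K s) ↔ ∃ v ∈ K.verts, vheight s v = a := by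
  rw [vertexHeights, map_vertices, Multiset.mem_sort, Multiset.mem_map]
  rfl

theorem vheight_axis (i : Fin d) (v : E d) : vheight (axis i) v = v i := by
  rw [vheight, axis, EuclideanSpace.inner_single_left]
  simp

variable [NeZero d]

/-- The points of `V` in ascending order of their first coordinates. -/
def sortedVerts (V : Finset (E d)) : List (E d) :=
  V.toList.mergeSort fun u v => decide (u 0 ≤ v 0)

theorem sortedVerts_perm (V : Finset (E d)) : (sortedVerts V).Perm V.toList :=
  List.mergeSort_perm _ _

@[simp] theorem mem_sortedVerts {V : Finset (E d)} {v : E d} : v ∈ sortedVerts V ↔ v ∈ V := by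
  rw [(sortedVerts_perm V).mem_iff, Finset.mem_toList]

theorem nodup_sortedVerts (V : Finset (E d)) : (sortedVerts V).Nodup :=
  (sortedVerts_perm V).nodup_iff.2 V.nodup_toList

theorem length_sortedVerts (V : Finset (E d)) : (sortedVerts V).length = V.card := by
  rw [(sortedVerts_perm V).length_eq, Finset.length_toList]

@[simp] theorem toFinset_sortedVerts (V : Finset (E d)) : (sortedVerts V).toFinset = V := by
  ext; simp

theorem coe_sortedVerts (V : Finset (E d)) : (sortedVerts V : Multiset (E d)) = V.val := by
  rw [Multiset.coe_eq_coe.2 (sortedVerts_perm V), Finset.coe_toList]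

theorem pairwise_sortedVerts {V : Finset (E d)} (h : ∀ u ∈ V, ∀ v ∈ V, u 0 = v 0 → u = v) :
    (sortedVerts V).Pairwise fun u v => u 0 < v 0 := by
  have h1 : (sortedVerts V).Pairwise fun u v => u 0 ≤ v 0 := by
    have := List.pairwise_mergeSort (le := fun u v : E d => decide (u 0 ≤ v 0))
      (fun a b c => by simpa using le_trans) (fun a b => by simpa using le_total _ _) V.toList
    simpa [sortedVerts] using this
  refine ((h1.and (nodup_sortedVerts V)).and (List.pairwise_of_forall_mem_list
    (r := fun u v => u ∈ V ∧ v ∈ V) fun u hu v hv =>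
      ⟨mem_sortedVerts.1 hu, mem_sortedVerts.1 hv⟩)).imp ?_
  rintro u v ⟨⟨h2, h3⟩, h4, h5⟩
  exact lt_of_le_of_ne h2 fun h6 => h3 (h u h4 v h5 h6)

theorem vertexHeights_axis_zero {K : Complex d}
    (hK : ∀ u ∈ K.verts, ∀ v ∈ K.verts, u 0 = v 0 → u = v) :
    vertexHeights (heightsDims K (axis 0)) = (sortedVerts K.verts).map fun v => v 0 := by
  have h : vheight (axis (0 : Fin d)) = fun v : E d => v 0 := funext (vheight_axis 0)
  rw [vertexHeights_eq (coe_sortedVerts _), h]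
  rw [h, List.pairwise_map]
  exact (pairwise_sortedVerts hK).imp fun h => h.le

/-- The tilt keeps the strict order of first coordinates, so equal positions in the two sorted lists
belong to the same vertex. The tilted height of `v` is `t 0 * v 0 + t i * v i`, which is solved for
`v i`. -/
theorem findCoord_result {K : Complex d}
    (hK : ∀ u ∈ K.verts, ∀ v ∈ K.verts, u 0 = v 0 → u = v) {i : Fin d} (hi : i ≠ 0) :
    (findCoord (vertexHeights (heightsDims K (axis 0))) i).result (heightsDims K) =
      (sortedVerts K.verts).map fun v => v i := by
  obtain ⟨ε, c, hε, hc, ht, hlt⟩ := tilt_spec (V := K.verts)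
    (H := vertexHeights (heightsDims K (axis 0))) (H' := vertexHeights (heightsDims K (axis i)))
    (s := axis 0) (s' := axis i) (fun _ => mem_vertexHeights) (fun _ => mem_vertexHeights)
  simp only [findCoord, result_bind, result_ask, result_pure]
  generalize tilt _ _ (axis 0) (axis i) = t at ht hlt ⊢
  have hb : vertexHeights (heightsDims K t) = (sortedVerts K.verts).map (vheight t) := by
    refine vertexHeights_eq (coe_sortedVerts _) (List.pairwise_map.2 ?_)
    refine ((pairwise_sortedVerts hK).and (List.pairwise_of_forall_mem_list
      (r := fun u v => u ∈ K.verts ∧ v ∈ K.verts) fun u hu v hv =>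
        ⟨mem_sortedVerts.1 hu, mem_sortedVerts.1 hv⟩)).imp ?_
    rintro u v ⟨h1, h2, h3⟩
    exact (hlt u h2 v h3 (by simpa only [vheight_axis] using h1)).le
  rw [hb, vertexHeights_axis_zero hK, List.zipWith_map, List.zipWith_self]
  refine List.map_congr_left fun v _ => ?_
  have h0 : (t : E d) 0 = c * (1 - ε) := by
    rw [ht]; simp [axis, hi]
  have h1 : (t : E d) i = c * ε := by
    rw [ht]; simp [axis, hi]
  have hv : vheight t v = c * ((1 - ε) * v 0 + ε * v i) := by
    rw [vheight, ht, real_inner_smul_left, inner_add_left, real_inner_smul_left,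
      real_inner_smul_left]
    change c * ((1 - ε) * vheight (axis 0) v + ε * vheight (axis i) v) = _
    rw [vheight_axis, vheight_axis]
  rw [h0, h1, hv]
  field_simp
  ring

/-- Distinct first coordinates are the only part of general position used here; this is what makes
the result applicable to an arbitrary competitor. -/
theorem findVerts_result {K : Complex d}
    (hK : ∀ u ∈ K.verts, ∀ v ∈ K.verts, u 0 = v 0 → u = v) :
    (findVerts : DirProg d _).result (heightsDims K) = (sortedVerts K.verts, K.dim) := by
  have hdim : ((heightsDims K (axis 0)).map Prod.snd).sup = K.dim := by
    rw [heightsDims, Multiset.map_map]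
    rfl
  have hcols : ∀ i : Fin d, (if i = 0 then pure (vertexHeights (heightsDims K (axis 0))) else
      findCoord (vertexHeights (heightsDims K (axis 0))) i : DirProg d (List ℝ)).result
        (heightsDims K) = (sortedVerts K.verts).map fun v => v i := by
    intro i
    split_ifs with h
    · rw [result_pure, vertexHeights_axis_zero hK, h]
    · exact findCoord_result hK h
  simp only [findVerts, result_bind, result_ask, result_pure, result_mapM, hdim, hcols]
  refine Prod.ext ?_ rfl
  simp only
  rw [vertexHeights_axis_zero hK, List.length_map]
  refine List.ext_getElem (by simp) fun j h1 h2 => ?_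
  ext i
  simp [h2]

theorem findVerts_length_queries (o : Dir d → Multiset (ℝ × ℕ)) :
    ((findVerts : DirProg d _).queries o).length ≤ 2 * d + 1 := by
  simp only [findVerts, queries_bind, queries_ask, queries_pure, result_ask, queries_mapM,
    List.append_nil, List.length_append, List.length_singleton, List.length_flatMap]
  have : ∀ i : Fin d, ((if i = 0 then pure (vertexHeights (o (axis 0))) else
      findCoord (vertexHeights (o (axis 0))) i : DirProg d (List ℝ)).queries o).length ≤ 2 := by
    intro i
    split_ifs
    · simp
    · simp [findCoord]
  have h2 := List.sum_le_card_nsmul ((List.finRange d).map fun i =>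
    ((if i = 0 then pure (vertexHeights (o (axis 0))) else
      findCoord (vertexHeights (o (axis 0))) i : DirProg d (List ℝ)).queries o).length) 2
    (by simpa using this)
  simp only [List.length_map, List.length_finRange, smul_eq_mul] at h2
  omega

/-- The vertices are determined by the answers of a complex whose vertices have distinct first
coordinates. -/
theorem verts_eq_of_answers {K K' : Complex d}
    (hK : ∀ u ∈ K.verts, ∀ v ∈ K.verts, u 0 = v 0 → u = v)
    (h : ∀ s ∈ (findVerts : DirProg d _).queries (heightsDims K),
      heightsDims K' s = heightsDims K s) :
    K'.verts = K.verts := by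
  have h0 : heightsDims K' (axis 0) = heightsDims K (axis 0) := h _ (by simp [findVerts])
  -- Nothing is assumed about `K'`, but its multiset of first coordinates is that of `K` and hence
  -- has no repetitions.
  have hK' : ∀ u ∈ K'.verts, ∀ v ∈ K'.verts, u 0 = v 0 → u = v := by
    have h1 := map_vertices K (axis (0 : Fin d))
    rw [← h0, map_vertices] at h1
    have h2 : (K.verts.val.map (vheight (axis 0))).Nodup :=
      Multiset.Nodup.map_on (fun u hu v hv huv => hK u hu v hv (by
        simpa only [vheight_axis] using huv)) K.verts.nodup
    rw [← h1] at h2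
    intro u hu v hv huv
    exact Multiset.inj_on_of_nodup_map h2 u hu v hv (by simpa only [vheight_axis] using huv)
  have := result_congr (findVerts : DirProg d _) h
  rw [findVerts_result hK, findVerts_result hK'] at this
  rw [← toFinset_sortedVerts K'.verts, (Prod.mk.inj this).1, toFinset_sortedVerts]

end DirectionalTransform

namespace DirectionalTransform

variable {d : ℕ}

open Prog

/-! ### Reconstruction of the edges -/

/-- The neighbors of `v` in the `1`-skeleton of `K`. -/
def nbrs (K : Complex d) (v : E d) : Finset (E d) :=
  K.verts.filter fun u => u ≠ v ∧ {u, v} ∈ K.simplices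

theorem mem_nbrs {K : Complex d} {u v : E d} :
    u ∈ nbrs K v ↔ u ≠ v ∧ {u, v} ∈ K.simplices := by
  rw [nbrs, Finset.mem_filter, and_iff_right_iff_imp]
  exact fun h => Complex.subset_verts h.2 (by simp)

theorem mem_verts_of_mem_nbrs {K : Complex d} {u v : E d} (h : u ∈ nbrs K v) : u ∈ K.verts :=
  (Finset.mem_filter.1 h).1

/-- Since `v` is the only vertex at its height, an edge of that height has `v` as its top vertex. -/
theorem simplexCount_one {K : Complex d} {s : Dir d} {v : E d}
    (hs : ∀ u ∈ K.verts, u ≠ v → vheight s u ≠ vheight s v) :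
    simplexCount (heightsDims K s) 1 (vheight s v) =
      ((nbrs K v).filter fun u => vheight s u < vheight s v).card := by
  rw [simplexCount_heightsDims]
  symm
  refine Finset.card_bij (fun u _ => {u, v}) ?_ ?_ ?_
  · intro u hu
    obtain ⟨hu, hlt⟩ := Finset.mem_filter.1 hu
    obtain ⟨hne, h⟩ := mem_nbrs.1 hu
    refine Finset.mem_filter.2 ⟨h, Finset.card_pair hne, (height_eq_iff (by simp)).2 ⟨?_, ?_⟩⟩
    · exact ⟨v, by simp, rfl⟩
    · simp [hlt.le]
  · intro u hu w hw h
    have hne := (mem_nbrs.1 (Finset.mem_filter.1 hu).1).1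
    have : u ∈ ({w, v} : Finset (E d)) := h ▸ by simp
    simpa [hne] using this
  · intro ρ hρ
    obtain ⟨h, hcard, hh⟩ := Finset.mem_filter.1 hρ
    obtain ⟨⟨w, hw, hwv⟩, hle⟩ := (height_eq_iff (Complex.nonempty_of_mem h)).1 hh
    have hwv : w = v := by
      by_contra hne
      exact hs w (Complex.subset_verts h hw) hne hwv
    subst hwv
    obtain ⟨u, hu⟩ : ∃ u, ρ.erase w = {u} := Finset.card_eq_one.1 (by
      rw [Finset.card_erase_of_mem hw, hcard])
    have hρ' : ρ = {u, w} := by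
      rw [← Finset.insert_erase hw, hu, Finset.pair_comm]
    have hne : u ≠ w := (Finset.mem_erase.1 (hu ▸ Finset.mem_singleton_self u)).1
    subst hρ'
    refine ⟨u, Finset.mem_filter.2 ⟨mem_nbrs.2 ⟨hne, h⟩, ?_⟩, rfl⟩
    exact lt_of_le_of_ne (hle u (by simp)) (hs u (Complex.subset_verts h (by simp)) hne)

theorem val_one_of_two_le [NeZero d] (hd : 2 ≤ d) : ((1 : Fin d) : ℕ) = 1 := by
  rw [Fin.coe_ofNat_eq_mod]
  exact Nat.mod_eq_of_lt hd

theorem zero_ne_one_of_two_le [NeZero d] (hd : 2 ≤ d) : (0 : Fin d) ≠ 1 := by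
  rw [Ne, Fin.ext_iff, Fin.val_zero, val_one_of_two_le hd]
  exact zero_ne_one

/-- The recursion is a binary tree with at most `n` leaves, hence at most `n - 1` splittings of two
queries each. Skipping intervals without neighbors is not exploited: a quadratic total for the edges
suffices. -/
theorem searchInterval_length_queries (o : Dir d → Multiset (ℝ × ℕ)) (pick : Set (Dir d) → Dir d)
    (V : Finset (E d)) (v : E d) (n : ℕ) :
    ∀ (interval : List (E d)) (count pending : ℤ) (known : Finset (E d)), interval.length = n →
      ((searchInterval pick V v interval count pending known).queries o).length ≤ 2 * (n - 1) := by
  induction n using Nat.strong_induction_on with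
  | _ n ih =>
  intro interval count pending known hn
  rw [searchInterval]
  split_ifs with h1 h2
  · simp
  · simp
  · simp only [queries_bind, queries_ask, result_ask, List.length_append, List.length_singleton]
    have hll : (interval.take (interval.length / 2)).length = n / 2 := by
      rw [List.length_take]; omega
    have hrl : (interval.drop (interval.length / 2)).length = n - n / 2 := by
      rw [List.length_drop, hn]
    refine le_trans (Nat.add_le_add_left (Nat.add_le_add_left
      (Nat.add_le_add (ih _ (by omega) _ _ _ _ hll) (ih _ (by omega) _ _ _ _ hrl)) _) _) ?_
    omega

variable [NeZero d]

/-- The slope of the line through the projections of `v` and `u` to the plane of the first two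
coordinates. -/
def slopeFrom (v u : E d) : ℝ := (u 1 - v 1) / (u 0 - v 0)

/-- For `u` to the right of `v`, lying above or below `v` is the sign of an affine function of the
slope. This is how the radial order controls heights. -/
theorem vheight_sub_of_plane (hd : 2 ≤ d) {s : Dir d}
    (hs : ∀ i : Fin d, 2 ≤ i.val → (s : E d) i = 0) {u v : E d} (h : u 0 ≠ v 0) :
    vheight s u - vheight s v =
      (u 0 - v 0) * ((s : E d) 0 + (s : E d) 1 * slopeFrom v u) := by
  have h01 := zero_ne_one_of_two_le hd
  have hsum : vheight s u - vheight s v =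
      (s : E d) 0 * (u 0 - v 0) + (s : E d) 1 * (u 1 - v 1) := by
    rw [vheight_sub, PiLp.inner_apply, ← Finset.sum_pair h01
      (f := fun i => (s : E d) i * (u i - v i))]
    symm
    refine Eq.trans (Finset.sum_subset (Finset.subset_univ _) fun i _ hi => ?_)
      (Finset.sum_congr rfl fun i _ => ?_)
    · rw [hs i, zero_mul]
      simp only [Finset.mem_insert, Finset.mem_singleton, not_or, Fin.ext_iff, Fin.val_zero,
        val_one_of_two_le hd] at hi
      omega
    · simp [mul_comm]
  have h0 : u 0 - v 0 ≠ 0 := sub_ne_zero.2 h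
  rw [hsum, slopeFrom]
  field_simp

/-- A line through `v` whose slope `m` separates the slopes of the two halves does the splitting,
with normal `(-m, 1)`. There are infinitely many such `m`, so one can avoid the slopes of all
vertices. -/
theorem splitDirs_nonempty (hd : 2 ≤ d) {V : Finset (E d)} {v : E d} {left right : List (E d)}
    (hV : ∀ u ∈ V, u ≠ v → u 0 ≠ v 0) (hl : left ≠ []) (hr : right ≠ [])
    (hl0 : ∀ u ∈ left, v 0 < u 0) (hr0 : ∀ u ∈ right, v 0 < u 0)
    (hlr : ∀ u ∈ left, ∀ w ∈ right, slopeFrom v u < slopeFrom v w) :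
    (splitDirs V v left right).Nonempty := by
  obtain ⟨a, ha, hamax⟩ := Finset.exists_max_image left.toFinset (slopeFrom v)
    (List.toFinset_nonempty_iff _ |>.2 hl)
  obtain ⟨b, hb, hbmin⟩ := Finset.exists_min_image right.toFinset (slopeFrom v)
    (List.toFinset_nonempty_iff _ |>.2 hr)
  simp only [List.mem_toFinset] at ha hamax hb hbmin
  obtain ⟨m, ⟨hm1, hm2⟩, hm⟩ := (Set.Ioo_infinite (hlr a ha b hb)).exists_notMem_finset
    (V.image (slopeFrom v))
  have h01 := (zero_ne_one_of_two_le hd).symm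
  let x : E d := EuclideanSpace.single 0 (-m) + EuclideanSpace.single 1 1
  have hx0 : x 0 = -m := by simp [x, h01.symm]
  have hx1 : x 1 = 1 := by simp [x, h01]
  have hx2 : ∀ i : Fin d, 2 ≤ i.val → x i = 0 := by
    intro i hi
    have h0 : i ≠ 0 := by
      rintro rfl
      simp at hi
    have h1 : i ≠ 1 := by
      rintro rfl
      rw [val_one_of_two_le hd] at hi
      omega
    simp [x, h0, h1]
  have hx : x ≠ 0 := by
    intro h
    rw [h] at hx1
    simp at hx1
  have hc : 0 < ‖x‖⁻¹ := inv_pos.2 (norm_pos_iff.2 hx)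
  have hplane : ∀ i : Fin d, 2 ≤ i.val → (normalize x : E d) i = 0 := by
    intro i hi
    rw [coe_normalize hx, PiLp.smul_apply, hx2 i hi, smul_zero]
  have key : ∀ u : E d, u 0 ≠ v 0 → vheight (normalize x) u - vheight (normalize x) v =
      ‖x‖⁻¹ * ((u 0 - v 0) * (slopeFrom v u - m)) := by
    intro u hu
    rw [vheight_sub_of_plane hd hplane hu, coe_normalize hx, PiLp.smul_apply, PiLp.smul_apply,
      hx0, hx1, smul_eq_mul, smul_eq_mul]
    ring
  refine ⟨normalize x, hplane, ?_, ?_, ?_⟩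
  · intro u hu
    have h1 := hl0 u hu
    rw [← sub_neg, key u h1.ne']
    exact mul_neg_of_pos_of_neg hc (mul_neg_of_pos_of_neg (sub_pos.2 h1)
      (by linarith [hamax u hu]))
  · intro u hu
    have h1 := hr0 u hu
    rw [← sub_pos, key u h1.ne']
    exact mul_pos hc (mul_pos (sub_pos.2 h1) (by linarith [hbmin u hu]))
  · intro u hu hne
    rw [← sub_ne_zero, key u (hV u hu hne)]
    refine mul_ne_zero hc.ne' (mul_ne_zero (sub_ne_zero.2 (hV u hu hne)) (sub_ne_zero.2 ?_))
    rintro rfl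
    exact hm (Finset.mem_image_of_mem _ hu)

/-- The binary search finds the neighbors in the interval, if `known` and `later` are the earlier
and the later neighbors. -/
theorem searchInterval_result (hd : 2 ≤ d) {pick : Set (Dir d) → Dir d}
    (hpick : ∀ A : Set (Dir d), A.Nonempty → pick A ∈ A) {K : Complex d} {v : E d}
    (hV : ∀ u ∈ K.verts, u ≠ v → u 0 ≠ v 0) (n : ℕ) :
    ∀ (interval : List (E d)) (known later : Finset (E d)) (count pending : ℤ),
      interval.length = n → (∀ u ∈ interval, v 0 < u 0) →
      interval.Pairwise (fun u w => slopeFrom v u < slopeFrom v w) →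
      (∀ u ∈ later, v 0 < u 0) →
      (∀ u ∈ interval, ∀ w ∈ later, slopeFrom v u < slopeFrom v w) →
      count = ((nbrs K v).filter fun u => u ∈ interval).card → pending = later.card →
      Disjoint known ((nbrs K v).filter fun u => u ∈ interval) → Disjoint known later →
      nbrs K v = known ∪ ((nbrs K v).filter fun u => u ∈ interval) ∪ later →
      (searchInterval pick K.verts v interval count pending known).result (heightsDims K) =
        known ∪ (nbrs K v).filter fun u => u ∈ interval := by
  induction n using Nat.strong_induction_on with
  | _ n ih =>
  intro interval known later count pending hlen hpos hsort hlpos hlater hcount hpend hd1 hd2 hN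
  rw [searchInterval]
  by_cases hc : count = 0
  · rw [if_pos hc, result_pure]
    rw [hc] at hcount
    have h0 : ((nbrs K v).filter fun u => u ∈ interval) = ∅ :=
      Finset.card_eq_zero.1 (by exact_mod_cast hcount.symm)
    rw [h0, Finset.union_empty]
  rw [if_neg hc]
  by_cases hle : interval.length ≤ 1
  · rw [dif_pos hle, result_pure]
    congr 1
    have hne : ((nbrs K v).filter fun u => u ∈ interval).Nonempty := by
      rw [Finset.nonempty_iff_ne_empty]
      intro h
      rw [h] at hcount
      exact hc (by simpa using hcount)
    obtain ⟨u, hu⟩ := hne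
    obtain ⟨hu1, hu2⟩ := Finset.mem_filter.1 hu
    obtain ⟨w, rfl⟩ := List.length_eq_one_iff.1
      (le_antisymm hle (List.length_pos_of_mem hu2))
    ext y
    simp only [List.mem_singleton] at hu2
    subst hu2
    simp only [List.mem_toFinset, List.mem_singleton, Finset.mem_filter]
    constructor
    · rintro rfl
      exact ⟨hu1, rfl⟩
    · exact fun h => h.2
  rw [dif_neg hle]
  set left := interval.take (interval.length / 2) with hleft
  set right := interval.drop (interval.length / 2) with hright
  have happ : left ++ right = interval := List.take_append_drop _ _
  have hll : left.length = interval.length / 2 := by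
    rw [hleft, List.length_take]; omega
  have hrl : right.length = interval.length - interval.length / 2 := by
    rw [hright, List.length_drop]
  have hlne : left ≠ [] := by
    rw [← List.length_pos_iff]; omega
  have hrne : right ≠ [] := by
    rw [← List.length_pos_iff]; omega
  have hmem : ∀ u, u ∈ interval ↔ u ∈ left ∨ u ∈ right := by
    intro u
    rw [← happ, List.mem_append]
  obtain ⟨hsl, hsr, hlr⟩ := List.pairwise_append.1 (happ ▸ hsort)
  have hs : pick (splitDirs K.verts v left right) ∈ splitDirs K.verts v left right :=
    hpick _ (splitDirs_nonempty hd hV hlne hrne (fun u hu => hpos u ((hmem u).2 (Or.inl hu)))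
      (fun u hu => hpos u ((hmem u).2 (Or.inr hu))) hlr)
  simp only [result_bind, result_ask]
  generalize pick (splitDirs K.verts v left right) = s at hs ⊢
  obtain ⟨hplane, hbelow, habove, hiso⟩ := hs
  -- The affine function of the slope is negative on the left half and positive on the right half,
  -- so it increases, and it stays positive at the larger slopes of `later`. Hence `pending` has to
  -- be subtracted only from the count in direction `-s`.
  have hlabove : ∀ u ∈ later, vheight s v < vheight s u := by
    intro u hu
    obtain ⟨a, ha⟩ := List.exists_mem_of_ne_nil _ hlne
    obtain ⟨b, hb⟩ := List.exists_mem_of_ne_nil _ hrne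
    have ha0 := hpos a ((hmem a).2 (Or.inl ha))
    have hb0 := hpos b ((hmem b).2 (Or.inr hb))
    have h1 := vheight_sub_of_plane hd hplane ha0.ne'
    have h2 := vheight_sub_of_plane hd hplane hb0.ne'
    have h3 := vheight_sub_of_plane hd hplane (hlpos u hu).ne'
    have h1' : (s : E d) 0 + (s : E d) 1 * slopeFrom v a < 0 :=
      neg_of_mul_neg_right (h1 ▸ sub_neg.2 (hbelow a ha)) (sub_pos.2 ha0).le
    have h2' : 0 < (s : E d) 0 + (s : E d) 1 * slopeFrom v b :=
      (mul_pos_iff_of_pos_left (sub_pos.2 hb0)).1 (h2 ▸ sub_pos.2 (habove b hb))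
    have h4 := hlr a ha b hb
    have h5 := hlater b ((hmem b).2 (Or.inr hb)) u hu
    have h6 : 0 < (s : E d) 1 := by
      by_contra! h
      nlinarith
    rw [← sub_pos, h3]
    exact mul_pos (sub_pos.2 (hlpos u hu)) (by nlinarith)
  have hmemN : ∀ u, u ∈ nbrs K v ↔
      u ∈ known ∨ (u ∈ nbrs K v ∧ (u ∈ left ∨ u ∈ right)) ∨ u ∈ later := by
    intro u
    conv_lhs => rw [hN]
    simp only [Finset.mem_union, Finset.mem_filter, hmem, or_assoc]
  have hdk : ∀ u ∈ known, u ∈ nbrs K v → u ∉ left ∧ u ∉ right := by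
    intro u hu huN
    have := Finset.disjoint_left.1 hd1 hu
    simp only [Finset.mem_filter, huN, true_and, hmem, not_or] at this
    exact this
  have hlr' : ∀ u ∈ left, u ∉ right := fun u h1 h2 => lt_irrefl _ (hlr u h1 u h2)
  have hll' : ∀ u ∈ interval, u ∉ later := fun u h1 h2 => lt_irrefl _ (hlater u h1 u h2)
  have hkN : known ⊆ nbrs K v := fun u hu => (hmemN u).2 (Or.inl hu)
  have hlN : later ⊆ nbrs K v := fun u hu => (hmemN u).2 (Or.inr (Or.inr hu))
  have hL : ((simplexCount (heightsDims K s) 1 (vheight s v) : ℕ) : ℤ) -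
      (known.filter fun u => vheight s u < vheight s v).card =
      ((nbrs K v).filter fun u => u ∈ left).card := by
    rw [simplexCount_one hiso, sub_eq_iff_eq_add, ← Nat.cast_add, ← Finset.card_union_of_disjoint]
    · congr 2
      ext u
      simp only [Finset.mem_filter, Finset.mem_union]
      constructor
      · rintro ⟨h1, h2⟩
        rcases (hmemN u).1 h1 with h | ⟨h, h | h⟩ | h
        · exact Or.inr ⟨h, h2⟩
        · exact Or.inl ⟨h1, h⟩
        · exact absurd (habove u h) h2.not_gt
        · exact absurd (hlabove u h) h2.not_gt
      · rintro (⟨h1, h2⟩ | ⟨h1, h2⟩)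
        · exact ⟨h1, hbelow u h2⟩
        · exact ⟨hkN h1, h2⟩
    · rw [Finset.disjoint_left]
      intro u h1 h2
      obtain ⟨h1, h3⟩ := Finset.mem_filter.1 h1
      exact (hdk u (Finset.mem_filter.1 h2).1 h1).1 h3
  have hR : ((simplexCount (heightsDims K (-s)) 1 (vheight (-s) v) : ℕ) : ℤ) -
      (known.filter fun u => vheight (-s) u < vheight (-s) v).card - pending =
      ((nbrs K v).filter fun u => u ∈ right).card := by
    rw [simplexCount_one (fun u hu hne => by simpa using hiso u hu hne), hpend,
      sub_eq_iff_eq_add, sub_eq_iff_eq_add, ← Nat.cast_add, ← Nat.cast_add,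
      ← Finset.card_union_of_disjoint, ← Finset.card_union_of_disjoint]
    · congr 2
      ext u
      simp only [Finset.mem_filter, Finset.mem_union, vheight_neg, neg_lt_neg_iff]
      constructor
      · rintro ⟨h1, h2⟩
        rcases (hmemN u).1 h1 with h | ⟨h, h | h⟩ | h
        · exact Or.inr ⟨h, h2⟩
        · exact absurd (hbelow u h) h2.not_gt
        · exact Or.inl (Or.inl ⟨h1, h⟩)
        · exact Or.inl (Or.inr h)
      · rintro ((⟨h1, h2⟩ | h1) | ⟨h1, h2⟩)
        · exact ⟨h1, habove u h2⟩
        · exact ⟨hlN h1, hlabove u h1⟩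
        · exact ⟨hkN h1, h2⟩
    · rw [Finset.disjoint_left]
      intro u h1 h2
      have h2 := (Finset.mem_filter.1 h2).1
      rcases Finset.mem_union.1 h1 with h1 | h1
      · exact (hdk u h2 (hkN h2)).2 (Finset.mem_filter.1 h1).2
      · exact Finset.disjoint_left.1 hd2 h2 h1
    · rw [Finset.disjoint_left]
      intro u h1 h2
      exact hll' u ((hmem u).2 (Or.inr (Finset.mem_filter.1 h1).2)) h2
  rw [hL, hR]
  -- During the search of the left half, neighbors in the right half count as later ones; afterwards
  -- those found on the left count as known.
  have hfirst := ih left.length (by omega) left known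
    (((nbrs K v).filter fun u => u ∈ right) ∪ later)
    ((nbrs K v).filter fun u => u ∈ left).card
    (pending + ((nbrs K v).filter fun u => u ∈ right).card) rfl
    (fun u hu => hpos u ((hmem u).2 (Or.inl hu))) hsl
    (by
      intro u hu
      rcases Finset.mem_union.1 hu with h | h
      · exact hpos u ((hmem u).2 (Or.inr (Finset.mem_filter.1 h).2))
      · exact hlpos u h)
    (by
      intro u hu w hw
      rcases Finset.mem_union.1 hw with h | h
      · exact hlr u hu w (Finset.mem_filter.1 h).2
      · exact hlater u ((hmem u).2 (Or.inl hu)) w h)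
    rfl
    (by
      rw [Finset.card_union_of_disjoint, hpend, Nat.cast_add, add_comm]
      rw [Finset.disjoint_left]
      intro u h1 h2
      exact hll' u ((hmem u).2 (Or.inr (Finset.mem_filter.1 h1).2)) h2)
    (by
      rw [Finset.disjoint_left]
      intro u h1 h2
      exact (hdk u h1 (hkN h1)).1 (Finset.mem_filter.1 h2).2)
    (by
      rw [Finset.disjoint_left]
      intro u h1 h2
      rcases Finset.mem_union.1 h2 with h | h
      · exact (hdk u h1 (hkN h1)).2 (Finset.mem_filter.1 h).2
      · exact Finset.disjoint_left.1 hd2 h1 h)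
    (by
      ext u
      rw [hmemN u]
      simp only [Finset.mem_union, Finset.mem_filter]
      tauto)
  rw [hfirst]
  have hsecond := ih right.length (by omega) right
    (known ∪ (nbrs K v).filter fun u => u ∈ left) later
    ((nbrs K v).filter fun u => u ∈ right).card pending rfl
    (fun u hu => hpos u ((hmem u).2 (Or.inr hu))) hsr hlpos
    (fun u hu w hw => hlater u ((hmem u).2 (Or.inr hu)) w hw) rfl hpend
    (by
      rw [Finset.disjoint_left]
      intro u h1 h2
      obtain ⟨h3, h4⟩ := Finset.mem_filter.1 h2
      rcases Finset.mem_union.1 h1 with h | h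
      · exact (hdk u h h3).2 h4
      · exact hlr' u (Finset.mem_filter.1 h).2 h4)
    (by
      rw [Finset.disjoint_left]
      intro u h1 h2
      rcases Finset.mem_union.1 h1 with h | h
      · exact Finset.disjoint_left.1 hd2 h h2
      · exact hll' u ((hmem u).2 (Or.inl (Finset.mem_filter.1 h).2)) h2)
    (by
      ext u
      rw [hmemN u]
      simp only [Finset.mem_union, Finset.mem_filter]
      tauto)
  rw [hsecond]
  ext u
  simp only [Finset.mem_union, Finset.mem_filter, hmem]
  tauto

theorem mem_radialAbove {V : Finset (E d)} {v u : E d} :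
    u ∈ radialAbove V v ↔ u ∈ V ∧ v 0 < u 0 := by
  rw [radialAbove, List.mem_mergeSort, Finset.mem_toList, Finset.mem_filter]

theorem length_radialAbove_le (V : Finset (E d)) (v : E d) :
    (radialAbove V v).length ≤ V.card := by
  rw [radialAbove, List.length_mergeSort, Finset.length_toList]
  exact Finset.card_filter_le _ _

/-- Equal slopes from `v` would make three projections collinear; this is where `not_collinear`
enters. -/
theorem pairwise_radialAbove {V : Finset (E d)} (hV : GeneralPosition V) {v : E d} (hv : v ∈ V) :
    (radialAbove V v).Pairwise fun u w => slopeFrom v u < slopeFrom v w := by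
  have h1 : (radialAbove V v).Pairwise fun u w => slopeFrom v u ≤ slopeFrom v w := by
    have := List.pairwise_mergeSort
      (le := fun u w : E d => decide (slopeFrom v u ≤ slopeFrom v w))
      (fun a b c => by simpa using le_trans) (fun a b => by simpa using le_total _ _)
      (V.filter fun u => v 0 < u 0).toList
    exact this.imp fun h => of_decide_eq_true h
  have h2 : (radialAbove V v).Nodup := by
    rw [radialAbove, (List.mergeSort_perm _ _).nodup_iff]
    exact Finset.nodup_toList _
  refine ((h1.and h2).and (List.pairwise_of_forall_mem_list
    (r := fun u w => (u ∈ V ∧ v 0 < u 0) ∧ (w ∈ V ∧ v 0 < w 0)) fun u hu w hw =>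
      ⟨mem_radialAbove.1 hu, mem_radialAbove.1 hw⟩)).imp ?_
  rintro u w ⟨⟨hle, hne⟩, ⟨hu, hu0⟩, ⟨hw, hw0⟩⟩
  refine lt_of_le_of_ne hle fun heq => ?_
  refine hV.not_collinear v hv u hu w hw (fun h => hu0.ne (congrArg (fun x : E d => x 0) h))
    (fun h => hw0.ne (congrArg (fun x : E d => x 0) h)) hne ?_
  refine (collinear_iff_of_mem (p₀ := !₂[v 0, v 1]) (by simp)).2 ⟨!₂[1, slopeFrom v u], ?_⟩
  have key : ∀ y : E d, v 0 < y 0 → slopeFrom v y = slopeFrom v u →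
      (!₂[y 0, y 1] : EuclideanSpace ℝ (Fin 2)) =
        (y 0 - v 0) • !₂[1, slopeFrom v u] +ᵥ !₂[v 0, v 1] := by
    intro y hy hs
    have : (y 0 - v 0) * slopeFrom v u = y 1 - v 1 := by
      rw [← hs, slopeFrom]
      exact mul_div_cancel₀ _ (sub_pos.2 hy).ne'
    ext i
    fin_cases i
    · simp
    · simp [this]
  intro p hp
  simp only [Set.mem_insert_iff, Set.mem_singleton_iff] at hp
  rcases hp with rfl | rfl | rfl
  · exact ⟨0, by simp⟩
  · exact ⟨_, key u hu0 rfl⟩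
  · exact ⟨_, key w hw0 heq.symm⟩

/-- The loop invariant is that all edges meeting the processed prefix are known. The prefix consists
of the vertices with smaller first coordinate than `v`, so all neighbors below `v` are known, while
the answer to `-axis 0` counts those above. -/
theorem findEdges_result (hd : 2 ≤ d) {pick : Set (Dir d) → Dir d}
    (hpick : ∀ A : Set (Dir d), A.Nonempty → pick A ∈ A) {K : Complex d}
    (hK : GeneralPosition K.verts) :
    (findEdges pick (sortedVerts K.verts)).result (heightsDims K) =
      K.simplices.filter fun ρ => ρ.card = 2 := by
  have hinv := foldlM_invariant (heightsDims K)
    (fun (edges : Finset (Finset (E d))) v => do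
      let known ← searchInterval pick K.verts v (radialAbove K.verts v)
        (simplexCount (heightsDims K (-axis 0)) 1 (vheight (-axis 0) v)) 0
        (K.verts.filter fun u => u ≠ v ∧ {u, v} ∈ edges)
      return edges ∪ known.image fun u => {u, v})
    (fun pre edges => edges = K.simplices.filter fun ρ => ρ.card = 2 ∧ ∃ u ∈ pre, u ∈ ρ)
    (sortedVerts K.verts) ∅ (by simp) ?_
  · simp only [findEdges, result_bind, result_ask, toFinset_sortedVerts]
    rw [hinv]
    refine Finset.filter_congr fun ρ hρ => and_iff_left ?_
    obtain ⟨u, hu⟩ := Complex.nonempty_of_mem hρ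
    exact ⟨u, mem_sortedVerts.2 (Complex.subset_verts hρ hu), hu⟩
  · rintro pre v post edges hsplit rfl
    have hsorted := pairwise_sortedVerts hK.injective
    rw [hsplit] at hsorted
    obtain ⟨-, hpost, hpre⟩ := List.pairwise_append.1 hsorted
    have hv : v ∈ K.verts := mem_sortedVerts.1 (by rw [hsplit]; simp)
    have hprelt : ∀ u ∈ pre, u 0 < v 0 := fun u hu => hpre u hu v (by simp)
    have hvpre : v ∉ pre := fun h => lt_irrefl _ (hprelt v h)
    have hpre' : ∀ u ∈ K.verts, u ∈ pre ↔ u 0 < v 0 := by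
      intro u hu
      refine ⟨hprelt u, fun h => ?_⟩
      have := mem_sortedVerts.2 hu
      rw [hsplit, List.mem_append, List.mem_cons] at this
      rcases this with h1 | rfl | h1
      · exact h1
      · exact absurd h (lt_irrefl _)
      · exact absurd h ((List.pairwise_cons.1 hpost).1 u h1).not_gt
    have hknown : (K.verts.filter fun u => u ≠ v ∧ {u, v} ∈
        K.simplices.filter fun ρ => ρ.card = 2 ∧ ∃ u ∈ pre, u ∈ ρ) =
        (nbrs K v).filter fun u => u 0 < v 0 := by
      ext u
      simp only [Finset.mem_filter, mem_nbrs, Finset.mem_insert, Finset.mem_singleton]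
      constructor
      · rintro ⟨h1, h2, h3, h4, w, hw, rfl | rfl⟩
        · exact ⟨⟨h2, h3⟩, (hpre' _ h1).1 hw⟩
        · exact absurd hw hvpre
      · rintro ⟨⟨h1, h2⟩, h3⟩
        have hu : u ∈ K.verts := Complex.subset_verts h2 (by simp)
        exact ⟨hu, h1, h2, Finset.card_pair h1, u, (hpre' u hu).2 h3, Or.inl rfl⟩
    have hradial : ((nbrs K v).filter fun u => u ∈ radialAbove K.verts v) =
        (nbrs K v).filter fun u => v 0 < u 0 :=
      Finset.filter_congr fun u hu => by
        rw [mem_radialAbove, and_iff_right (mem_verts_of_mem_nbrs hu)]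
    have hV : ∀ u ∈ K.verts, u ≠ v → u 0 ≠ v 0 :=
      fun u hu hne h => hne (hK.injective u hu v hv h)
    have hall : ((nbrs K v).filter fun u => u 0 < v 0 ∨ v 0 < u 0) = nbrs K v :=
      Finset.filter_true_of_mem fun u hu =>
        (hV u (mem_verts_of_mem_nbrs hu) (mem_nbrs.1 hu).1).lt_or_gt
    have hsearch := searchInterval_result hd hpick hV _ (radialAbove K.verts v)
      ((nbrs K v).filter fun u => u 0 < v 0) ∅
      (simplexCount (heightsDims K (-axis 0)) 1 (vheight (-axis 0) v)) 0 rfl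
      (fun u hu => (mem_radialAbove.1 hu).2) (pairwise_radialAbove hK hv) (by simp) (by simp)
      (by
        rw [simplexCount_one (fun u hu hne => by
          simpa only [vheight_neg, vheight_axis, ne_eq, neg_inj] using hV u hu hne), hradial]
        simp only [vheight_neg, vheight_axis, neg_lt_neg_iff])
      (by simp)
      (by
        rw [hradial, Finset.disjoint_left]
        intro u h1 h2
        exact (Finset.mem_filter.1 h1).2.not_gt (Finset.mem_filter.1 h2).2)
      (by simp)
      (by
        rw [hradial, Finset.union_empty, ← Finset.filter_or, hall])
    simp only [result_bind, result_pure]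
    rw [hknown, hsearch, hradial, ← Finset.filter_or, hall]
    ext ρ
    simp only [Finset.mem_union, Finset.mem_filter, Finset.mem_image, List.mem_append,
      List.mem_singleton]
    constructor
    · rintro (⟨h1, h2, u, h3, h4⟩ | ⟨u, hu, rfl⟩)
      · exact ⟨h1, h2, u, Or.inl h3, h4⟩
      · obtain ⟨h1, h2⟩ := mem_nbrs.1 hu
        exact ⟨h2, Finset.card_pair h1, v, Or.inr rfl, by simp⟩
    · rintro ⟨h1, h2, u, h3 | rfl, h4⟩
      · exact Or.inl ⟨h1, h2, u, h3, h4⟩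
      · obtain ⟨w, hw⟩ : ∃ w, ρ.erase u = {w} := Finset.card_eq_one.1 (by
          rw [Finset.card_erase_of_mem h4, h2])
        have hρ' : {w, u} = ρ := by
          rw [← Finset.insert_erase h4, hw, Finset.pair_comm]
        have hne : w ≠ u := (Finset.mem_erase.1 (hw ▸ Finset.mem_singleton_self w)).1
        exact Or.inr ⟨w, mem_nbrs.2 ⟨hne, by rwa [hρ']⟩, hρ'⟩

theorem findEdges_length_queries (o : Dir d → Multiset (ℝ × ℕ)) (pick : Set (Dir d) → Dir d)
    (V : Finset (E d)) :
    ((findEdges pick (sortedVerts V)).queries o).length ≤ 1 + V.card * (2 * V.card) := by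
  simp only [findEdges, queries_bind, queries_ask, result_ask, List.length_append,
    List.length_singleton, toFinset_sortedVerts]
  refine Nat.add_le_add_left ?_ _
  refine (length_queries_foldlM_le o _ (2 * V.card) _ _ ?_).trans (by rw [length_sortedVerts])
  intro v _ edges
  rw [queries_bind, queries_pure, List.append_nil]
  refine (searchInterval_length_queries o pick V v _ _ _ _ _ rfl).trans ?_
  have := length_radialAbove_le V v
  omega

end DirectionalTransform

namespace DirectionalTransform

variable {d : ℕ}

open Prog

/-! ### Proper faces -/

theorem mem_properFaces {σ τ : Finset (E d)} :
    τ ∈ properFaces σ ↔ τ ⊆ σ ∧ τ.Nonempty ∧ τ.card < σ.card := by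
  simp only [properFaces, List.mem_flatMap, List.mem_range'_1, Finset.mem_toList,
    Finset.mem_powersetCard, ← Finset.card_pos]
  constructor
  · rintro ⟨j, ⟨h1, h2⟩, h3, rfl⟩
    exact ⟨h3, h1, by omega⟩
  · rintro ⟨h1, h2, h3⟩
    exact ⟨τ.card, ⟨h2, by omega⟩, h1, rfl⟩

theorem nodup_properFaces (σ : Finset (E d)) : (properFaces σ).Nodup := by
  refine List.nodup_flatMap.2 ⟨fun j _ => Finset.nodup_toList _, ?_⟩
  refine (List.pairwise_lt_range' (s := 1) (n := σ.card - 1)).imp fun {i j} hij => ?_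
  intro τ h1 h2
  rw [Finset.mem_toList, Finset.mem_powersetCard] at h1 h2
  exact hij.ne (h1.2.symm.trans h2.2)

/-- This order guarantees that the table holds the values of all proper faces of `τ` when `τ` is
reached. -/
theorem pairwise_properFaces (σ : Finset (E d)) :
    (properFaces σ).Pairwise fun τ τ' => τ.card ≤ τ'.card := by
  refine List.pairwise_flatMap.2 ⟨fun j _ => ?_, ?_⟩
  · refine List.pairwise_of_forall_mem_list fun τ h1 τ' h2 => ?_
    rw [Finset.mem_toList, Finset.mem_powersetCard] at h1 h2
    rw [h1.2, h2.2]
  · refine (List.pairwise_lt_range' (s := 1) (n := σ.card - 1)).imp fun {i j} hij τ h1 τ' h2 => ?_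
    rw [Finset.mem_toList, Finset.mem_powersetCard] at h1 h2
    rw [h1.2, h2.2]
    exact hij.le

/-- The empty set is not listed. Strictness leaves room for the query in the direction `s` itself in
`indegree_length_queries`. -/
theorem length_properFaces_lt (σ : Finset (E d)) : (properFaces σ).length < 2 ^ σ.card := by
  rw [← List.toFinset_card_of_nodup (nodup_properFaces σ), ← Finset.card_powerset]
  refine Finset.card_lt_card (Finset.ssubset_iff_subset_ne.2 ⟨fun τ hτ => ?_, fun h => ?_⟩)
  · exact Finset.mem_powerset.2 (mem_properFaces.1 (List.mem_toFinset.1 hτ)).1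
  · have : ∅ ∈ (properFaces σ).toFinset := h ▸ Finset.empty_mem_powerset σ
    simpa using (mem_properFaces.1 (List.mem_toFinset.1 this)).2.1

theorem sum_properFaces_add {M : Type*} [AddCommMonoid M] {σ : Finset (E d)} (hσ : σ.Nonempty)
    (f : Finset (E d) → M) :
    ((properFaces σ).map f).sum + f σ = ∑ τ ∈ σ.powerset.filter Finset.Nonempty, f τ := by
  have h : σ.powerset.filter Finset.Nonempty = insert σ (properFaces σ).toFinset := by
    ext τ
    rw [Finset.mem_filter, Finset.mem_powerset, Finset.mem_insert, List.mem_toFinset,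
      mem_properFaces]
    constructor
    · rintro ⟨h1, h2⟩
      by_cases h3 : τ = σ
      · exact Or.inl h3
      · exact Or.inr ⟨h1, h2, Finset.card_lt_card (h1.ssubset_of_ne h3)⟩
    · rintro (rfl | ⟨h1, h2, -⟩)
      · exact ⟨subset_rfl, hσ⟩
      · exact ⟨h1, h2⟩
  rw [h, Finset.sum_insert, List.sum_toFinset _ (nodup_properFaces σ), add_comm]
  rw [List.mem_toFinset, mem_properFaces]
  exact fun h => lt_irrefl _ h.2.2

/-! ### Indegrees -/

/-- The `k`-simplices that meet `σ` in `τ` and are otherwise below `σ`. -/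
def lowerCofaces (K : Complex d) (s : Dir d) (k : ℕ) (σ τ : Finset (E d)) :
    Finset (Finset (E d)) :=
  K.simplices.filter fun ρ => ρ.card = k + 1 ∧ ρ ∩ σ = τ ∧
    ∀ u ∈ ρ, u ∉ σ → vheight s u < height s σ

/-- As only `σ` lies at its height, `ρ` has this height iff it meets `σ` and its vertices outside
`σ` are below. The count is then taken fiberwise over `ρ ∩ σ`. -/
theorem simplexCount_eq_sum [NeZero d] {K : Complex d} {s : Dir d} {k : ℕ} {σ : Finset (E d)}
    (hσ : σ.Nonempty) (hs : s ∈ isolatingDirs K.verts σ) :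
    (simplexCount (heightsDims K s) k (height s σ) : ℤ) =
      ((properFaces σ).map fun τ => ((lowerCofaces K s k σ τ).card : ℤ)).sum +
        (lowerCofaces K s k σ σ).card := by
  rw [sum_properFaces_add hσ fun τ => ((lowerCofaces K s k σ τ).card : ℤ), ← Nat.cast_sum,
    simplexCount_heightsDims, Nat.cast_inj]
  have hperp : ∀ u ∈ σ, vheight s u = height s σ := fun u hu => (height_of_perp hs.1 hu).symm
  have hiff : ∀ ρ ∈ K.simplices, height s ρ = height s σ ↔
      (ρ ∩ σ).Nonempty ∧ ∀ u ∈ ρ, u ∉ σ → vheight s u < height s σ := by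
    intro ρ hρ
    have hne : ∀ u ∈ ρ, u ∉ σ → vheight s u ≠ height s σ := by
      intro u hu huσ h
      obtain ⟨w, hw⟩ := hσ
      exact hs.2 w hw u (Complex.subset_verts hρ hu) huσ ((hperp w hw).trans h.symm)
    rw [height_eq_iff (Complex.nonempty_of_mem hρ)]
    constructor
    · rintro ⟨⟨u, hu, huh⟩, hle⟩
      refine ⟨⟨u, Finset.mem_inter.2 ⟨hu, ?_⟩⟩, fun w hw hwσ =>
        lt_of_le_of_ne (hle w hw) (hne w hw hwσ)⟩
      by_contra h
      exact hne u hu h huh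
    · rintro ⟨⟨u, hu⟩, hlt⟩
      obtain ⟨hu, huσ⟩ := Finset.mem_inter.1 hu
      refine ⟨⟨u, hu, hperp u huσ⟩, fun w hw => ?_⟩
      by_cases hwσ : w ∈ σ
      · exact (hperp w hwσ).le
      · exact (hlt w hw hwσ).le
  rw [Finset.card_eq_sum_card_fiberwise (f := fun ρ => ρ ∩ σ)
    (t := σ.powerset.filter Finset.Nonempty)]
  · refine Finset.sum_congr rfl fun τ hτ => ?_
    congr 1
    ext ρ
    simp only [lowerCofaces, Finset.mem_filter]
    constructor
    · rintro ⟨⟨h1, h2, h3⟩, h4⟩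
      exact ⟨h1, h2, h4, ((hiff ρ h1).1 h3).2⟩
    · rintro ⟨h1, h2, h3, h4⟩
      exact ⟨⟨h1, h2, (hiff ρ h1).2 ⟨h3 ▸ (Finset.mem_filter.1 hτ).2, h4⟩⟩, h3⟩
  · intro ρ hρ
    obtain ⟨h1, h2, h3⟩ := Finset.mem_filter.1 hρ
    exact Finset.mem_filter.2 ⟨Finset.mem_powerset.2 Finset.inter_subset_right,
      ((hiff ρ h1).1 h3).1⟩

variable [NeZero d]

section Face

variable {K : Complex d} {s s' : Dir d} {σ τ : Finset (E d)}

theorem tiltV_mem_isolatingDirs (hσ : σ ⊆ K.verts) (hs : s ∈ isolatingDirs K.verts σ)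
    (hτ : τ ⊆ σ) (hs' : s' ∈ belowDirs τ (σ \ τ)) :
    tiltV K.verts s s' ∈ isolatingDirs K.verts τ := by
  refine ⟨fun u hu w hw => tiltV_eq_of_eq (hs.1 u (hτ hu) w (hτ hw)) (hs'.1 u hu w hw), ?_⟩
  intro u hu q hq hqτ
  by_cases hqσ : q ∈ σ
  · exact (tiltV_lt_of_eq (hs.1 u (hτ hu) q hqσ)
      (hs'.2 u hu q (Finset.mem_sdiff.2 ⟨hqσ, hqτ⟩))).ne
  · exact tiltV_ne (hσ (hτ hu)) hq (hs.2 u (hτ hu) q hq hqσ)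

/-- The tilt lifts `σ \ τ` above `τ` and leaves every vertex outside `σ` on its side. So a simplex
whose vertices outside `τ` are below `τ` avoids `σ \ τ`, and meets `σ` where it meets `τ`. For `τ' =
τ` the summand of `τ` becomes an indegree in the tilted direction; for smaller `τ'` the stored value
stays valid in this direction, so one query per face is enough. -/
theorem lowerCofaces_tiltV (hσ : σ ⊆ K.verts) (hs : s ∈ isolatingDirs K.verts σ)
    (hτ : τ ⊆ σ) (hτne : τ.Nonempty) (hs' : s' ∈ belowDirs τ (σ \ τ)) (k : ℕ)
    {τ' : Finset (E d)} (hτ' : τ' ⊆ τ) :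
    lowerCofaces K (tiltV K.verts s s') k τ τ' = lowerCofaces K s k σ τ' := by
  obtain ⟨w, hw⟩ := hτne
  have ht := tiltV_mem_isolatingDirs hσ hs hτ hs'
  refine Finset.filter_congr fun ρ hρ => and_congr_right fun _ => ?_
  rw [height_of_perp ht.1 hw, height_of_perp hs.1 (hτ hw)]
  have habove : ∀ u ∈ σ, u ∉ τ →
      vheight (tiltV K.verts s s') w < vheight (tiltV K.verts s s') u :=
    fun u hu hu' => tiltV_lt_of_eq (hs.1 w (hτ hw) u hu)
      (hs'.2 w hw u (Finset.mem_sdiff.2 ⟨hu, hu'⟩))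
  have hiff : ∀ u ∈ ρ, u ∉ σ → (vheight (tiltV K.verts s s') u <
      vheight (tiltV K.verts s s') w ↔ vheight s u < vheight s w) :=
    fun u hu hu' => tiltV_lt_iff (Complex.subset_verts hρ hu) (hσ (hτ hw))
      (hs.2 w (hτ hw) u (Complex.subset_verts hρ hu) hu').symm
  constructor
  · rintro ⟨h1, h2⟩
    refine ⟨?_, fun u hu hu' => (hiff u hu hu').1 (h2 u hu fun h => hu' (hτ h))⟩
    rw [← h1]
    refine Finset.Subset.antisymm (fun u hu => ?_) (Finset.inter_subset_inter_left hτ)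
    obtain ⟨hu, huσ⟩ := Finset.mem_inter.1 hu
    refine Finset.mem_inter.2 ⟨hu, ?_⟩
    by_contra h
    exact (h2 u hu h).not_gt (habove u huσ h)
  · rintro ⟨h1, h2⟩
    have h3 : ∀ u ∈ ρ, u ∈ σ → u ∈ τ := fun u hu huσ =>
      hτ' (h1 ▸ Finset.mem_inter.2 ⟨hu, huσ⟩)
    refine ⟨?_, fun u hu hu' => ?_⟩
    · rw [← h1]
      refine Finset.Subset.antisymm (Finset.inter_subset_inter_left hτ) (fun u hu => ?_)
      obtain ⟨hu, huσ⟩ := Finset.mem_inter.1 hu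
      exact Finset.mem_inter.2 ⟨hu, h3 u hu huσ⟩
    · have huσ : u ∉ σ := fun h => hu' (h3 u hu h)
      exact (hiff u hu huσ).2 (h2 u hu huσ)

variable {pick : Set (Dir d) → Dir d}

theorem indegree_result (hpick : ∀ A : Set (Dir d), A.Nonempty → pick A ∈ A)
    (hσ : σ ⊆ K.verts) (hσne : σ.Nonempty) (hind : AffineIndependent ℝ ((↑) : σ → E d))
    (hs : s ∈ isolatingDirs K.verts σ) (k : ℕ) :
    (indegree pick K.verts σ s k).result (heightsDims K) = (lowerCofaces K s k σ σ).card := by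
  have hinv := foldlM_invariant (heightsDims K)
    (fun (table : Finset (E d) → ℤ) τ => do
      let t := tiltV K.verts s (pick (belowDirs τ (σ \ τ)))
      let b ← ask t
      return Function.update table τ
        ((simplexCount b k (height t τ) : ℤ) - ((properFaces τ).map table).sum))
    (fun pre table => ∀ τ ∈ pre, table τ = (lowerCofaces K s k σ τ).card)
    (properFaces σ) (fun _ => 0) (by simp) ?_
  · simp only [indegree, result_bind, result_ask, result_pure]
    rw [List.map_congr_left hinv, simplexCount_eq_sum hσne hs, add_sub_cancel_left]
  · intro pre τ post table hsplit htable
    simp only [result_bind, result_ask, result_pure]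
    have hnd := nodup_properFaces σ
    have hpw := pairwise_properFaces σ
    rw [hsplit] at hnd hpw
    obtain ⟨hτσ, hτne, hcard⟩ := mem_properFaces.1
      (show τ ∈ properFaces σ by rw [hsplit]; simp)
    have hs' : pick (belowDirs τ (σ \ τ)) ∈ belowDirs τ (σ \ τ) := by
      refine hpick _ (belowDirs_nonempty hind hτσ Finset.sdiff_subset Finset.disjoint_sdiff hτne ?_)
      rw [Finset.sdiff_nonempty]
      exact fun h => (Finset.card_le_card h).not_gt hcard
    generalize pick (belowDirs τ (σ \ τ)) = s' at hs' ⊢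
    -- The entry of `τ'` was computed with another tilt of `s`; both tilts count the same simplices
    -- as `s` does. That `τ'` precedes `τ` follows from its smaller cardinality.
    have hface : ∀ τ' ∈ properFaces τ, table τ' =
        (lowerCofaces K (tiltV K.verts s s') k τ τ').card := by
      intro τ' hτ'
      obtain ⟨h1, h2, h3⟩ := mem_properFaces.1 hτ'
      rw [lowerCofaces_tiltV hσ hs hτσ hτne hs' k h1]
      refine htable τ' ?_
      have : τ' ∈ properFaces σ := mem_properFaces.2 ⟨h1.trans hτσ, h2, h3.trans hcard⟩
      rw [hsplit, List.mem_append] at this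
      refine this.resolve_right fun h => ?_
      rcases List.mem_cons.1 h with rfl | h
      · exact lt_irrefl _ h3
      · exact ((List.pairwise_cons.1 (List.pairwise_append.1 hpw).2.1).1 τ' h).not_gt h3
    intro τ' hτ'
    rcases List.mem_append.1 hτ' with h | h
    · have hne : τ' ≠ τ := by
        rintro rfl
        exact (List.nodup_append.1 hnd).2.2 _ h _ (by simp) rfl
      rw [Function.update_of_ne hne, htable τ' h]
    · obtain rfl := List.mem_singleton.1 h
      rw [Function.update_self, List.map_congr_left hface,
        simplexCount_eq_sum hτne (tiltV_mem_isolatingDirs hσ hs hτσ hs'), add_sub_cancel_left,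
        lowerCofaces_tiltV hσ hs hτσ hτne hs' k subset_rfl]

end Face

theorem indegree_length_queries (o : Dir d → Multiset (ℝ × ℕ)) (pick : Set (Dir d) → Dir d)
    (V σ : Finset (E d)) (s : Dir d) (k : ℕ) :
    ((indegree pick V σ s k).queries o).length ≤ 2 ^ σ.card := by
  simp only [indegree, queries_bind, queries_ask, result_ask, List.length_append,
    List.length_singleton, queries_pure, List.append_nil]
  refine (Nat.add_le_add_left (length_queries_foldlM_le o _ 1 (properFaces σ) _
    fun τ _ table => by simp) _).trans ?_
  have := length_properFaces_lt σ
  omega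

/-! ### Reconstruction of the higher simplices -/

/-- In direction `s` the set `insert v σ` is alone at its height. Tilting `s` lifts `v` above `σ`,
negating the tilt of `-s` puts it below, and all other vertices keep their side. A coface of `σ`
with `σ.card + 1` vertices that contains `v` is `insert v σ` itself, so only this one can be counted
in `upper` but not in `lower`. -/
theorem isSimplex_result {pick : Set (Dir d) → Dir d}
    (hpick : ∀ A : Set (Dir d), A.Nonempty → pick A ∈ A) {K : Complex d}
    (hK : GeneralPosition K.verts) {σ : Finset (E d)} (hσ : σ ∈ K.simplices)
    (hcard : σ.card + 1 ≤ d) {v : E d} (hv : v ∈ K.verts) (hvσ : v ∉ σ) :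
    (isSimplex pick K.verts σ v).result (heightsDims K) =
      decide (insert v σ ∈ K.simplices) := by
  have hσV := Complex.subset_verts hσ
  have hσne := Complex.nonempty_of_mem hσ
  have hPV : insert v σ ⊆ K.verts := Finset.insert_subset hv hσV
  have hPcard : (insert v σ).card = σ.card + 1 := Finset.card_insert_of_notMem hvσ
  have hPind := hK.affineIndependent _ hPV (by omega)
  -- Here dimension below `d` is used: `insert v σ` has at most `d` points, and one further vertex
  -- stays within the `d + 1` points covered by general position.
  have hiso := isolatingDirs_nonempty (V := K.verts) (P := insert v σ) (by omega)
    (Finset.insert_nonempty _ _) fun q hq hqP =>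
      hK.affineIndependent _ (Finset.insert_subset hq hPV)
        ((Finset.card_insert_le _ _).trans (by omega))
  have h1 : pick (perpDirs (insert v σ)) ∈ perpDirs (insert v σ) :=
    hpick _ (hiso.mono fun s hs => hs.1)
  have h2 := hpick _ hiso
  have h3 : pick (belowDirs σ {v}) ∈ belowDirs σ {v} :=
    hpick _ (belowDirs_nonempty hPind (Finset.subset_insert _ _) (by simp) (by simpa using hvσ)
      hσne (Finset.singleton_nonempty v))
  simp only [isSimplex, result_bind, result_pure]
  generalize pick (perpDirs (insert v σ)) = s₁ at h1 ⊢
  generalize pick (isolatingDirs K.verts (insert v σ)) = s₂ at h2 ⊢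
  generalize pick (belowDirs σ {v}) = s₃ at h3 ⊢
  have hs : tiltV K.verts s₁ s₂ ∈ isolatingDirs K.verts (insert v σ) := by
    refine ⟨fun u hu w hw => tiltV_eq_of_eq (h1 u hu w hw) (h2.1 u hu w hw), ?_⟩
    intro u hu q hq hqP
    by_cases h : vheight s₁ u = vheight s₁ q
    · rcases (h2.2 u hu q hq hqP).lt_or_gt with h' | h'
      · exact (tiltV_lt_of_eq h h').ne
      · exact (tiltV_lt_of_eq h.symm h').ne'
    · exact tiltV_ne (hPV hu) hq h
  generalize tiltV K.verts s₁ s₂ = s at hs ⊢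
  have hσP : ∀ u ∈ σ, u ∈ insert v σ := fun u hu => Finset.mem_insert_of_mem hu
  have hvP : v ∈ insert v σ := Finset.mem_insert_self _ _
  have hperp : ∀ r : Dir d, (∀ u ∈ σ, ∀ w ∈ σ, vheight r u = vheight r w) →
      ∀ u ∈ σ, ∀ w ∈ σ, vheight (tiltV K.verts r s₃) u = vheight (tiltV K.verts r s₃) w :=
    fun r hr u hu w hw => tiltV_eq_of_eq (hr u hu w hw) (h3.1 u hu w hw)
  have hsv : ∀ u ∈ σ, vheight s u = vheight s v := fun u hu => hs.1 u (hσP u hu) v hvP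
  have hsσ : ∀ u ∈ σ, ∀ w ∈ σ, vheight s u = vheight s w :=
    fun u hu w hw => hs.1 u (hσP u hu) w (hσP w hw)
  have hsq : ∀ u ∈ σ, ∀ q ∈ K.verts, q ∉ σ → q ≠ v → vheight s u ≠ vheight s q :=
    fun u hu q hq hqσ hqv => hs.2 u (hσP u hu) q hq (by simp [hqσ, hqv])
  have hlow_v : ∀ u ∈ σ, vheight (tiltV K.verts s s₃) u < vheight (tiltV K.verts s s₃) v :=
    fun u hu => tiltV_lt_of_eq (hsv u hu) (h3.2 u hu v (by simp))
  have hup_v : ∀ u ∈ σ,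
      vheight (tiltV K.verts (-s) s₃) u < vheight (tiltV K.verts (-s) s₃) v :=
    fun u hu => tiltV_lt_of_eq (by simpa using hsv u hu) (h3.2 u hu v (by simp))
  have hlow : tiltV K.verts s s₃ ∈ isolatingDirs K.verts σ := by
    refine ⟨hperp s hsσ, fun u hu q hq hqσ => ?_⟩
    by_cases hqv : q = v
    · rw [hqv]
      exact (hlow_v u hu).ne
    · exact tiltV_ne (hσV hu) hq (hsq u hu q hq hqσ hqv)
  have hup : -tiltV K.verts (-s) s₃ ∈ isolatingDirs K.verts σ := by
    refine ⟨fun u hu w hw => ?_, fun u hu q hq hqσ => ?_⟩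
    · rw [vheight_neg, vheight_neg,
        hperp (-s) (fun u hu w hw => by simpa using hsσ u hu w hw) u hu w hw]
    · rw [vheight_neg, vheight_neg, ne_eq, neg_inj]
      by_cases hqv : q = v
      · rw [hqv]
        exact (hup_v u hu).ne
      · exact tiltV_ne (hσV hu) hq (by simpa using hsq u hu q hq hqσ hqv)
  have hind := hK.affineIndependent σ hσV (by omega)
  rw [indegree_result hpick hσV hσne hind hup, indegree_result hpick hσV hσne hind hlow]
  have hsets : lowerCofaces K (tiltV K.verts s s₃) σ.card σ σ =
      (lowerCofaces K (-tiltV K.verts (-s) s₃) σ.card σ σ).erase (insert v σ) := by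
    obtain ⟨w, hw⟩ := hσne
    ext ρ
    simp only [lowerCofaces, Finset.mem_erase, Finset.mem_filter, height_of_perp hlow.1 hw,
      height_of_perp hup.1 hw, Finset.inter_eq_right]
    have key : ∀ u ∈ K.verts, u ∉ σ → u ≠ v →
        (vheight (tiltV K.verts s s₃) u < vheight (tiltV K.verts s s₃) w ↔
          vheight (-tiltV K.verts (-s) s₃) u < vheight (-tiltV K.verts (-s) s₃) w) := by
      intro u hu huσ huv
      have hne := hsq w hw u hu huσ huv
      rw [tiltV_lt_iff hu (hσV hw) hne.symm, vheight_neg, vheight_neg, neg_lt_neg_iff,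
        tiltV_lt_iff (hσV hw) hu (by simpa using hne), vheight_neg, vheight_neg, neg_lt_neg_iff]
    constructor
    · rintro ⟨hρ, hc, hsub, hlt⟩
      have hvρ : v ∉ ρ := fun h => (hlt v h hvσ).not_gt (hlow_v w hw)
      refine ⟨fun h => hvρ (h ▸ hvP), hρ, hc, hsub, fun u hu huσ => ?_⟩
      exact (key u (Complex.subset_verts hρ hu) huσ fun h => hvρ (h ▸ hu)).1 (hlt u hu huσ)
    · rintro ⟨hne, hρ, hc, hsub, hlt⟩
      have hvρ : v ∉ ρ := fun h => hne
        (Finset.eq_of_subset_of_card_le (Finset.insert_subset h hsub) (by omega)).symm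
      refine ⟨hρ, hc, hsub, fun u hu huσ => ?_⟩
      exact (key u (Complex.subset_verts hρ hu) huσ fun h => hvρ (h ▸ hu)).2 (hlt u hu huσ)
  have hmem : insert v σ ∈ lowerCofaces K (-tiltV K.verts (-s) s₃) σ.card σ σ ↔
      insert v σ ∈ K.simplices := by
    obtain ⟨w, hw⟩ := hσne
    rw [lowerCofaces, Finset.mem_filter, and_iff_left_iff_imp]
    refine fun _ => ⟨hPcard, by simp, fun u hu huσ => ?_⟩
    obtain rfl : u = v := (Finset.mem_insert.1 hu).resolve_right huσ
    rw [height_of_perp hup.1 hw, vheight_neg, vheight_neg, neg_lt_neg_iff]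
    exact hup_v w hw
  rw [hsets]
  refine decide_eq_decide.2 ?_
  by_cases h : insert v σ ∈ K.simplices
  · have := Finset.card_erase_add_one (hmem.2 h)
    rw [← this]
    simp [h]
  · rw [Finset.erase_eq_of_notMem fun h' => h (hmem.1 h')]
    simp [h]

theorem isSimplex_length_queries (o : Dir d → Multiset (ℝ × ℕ)) (pick : Set (Dir d) → Dir d)
    (V σ : Finset (E d)) (v : E d) :
    ((isSimplex pick V σ v).queries o).length ≤ 2 * 2 ^ σ.card := by
  simp only [isSimplex, queries_bind, queries_pure, List.append_nil, List.length_append]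
  rw [two_mul]
  exact Nat.add_le_add (indegree_length_queries o pick V σ _ _)
    (indegree_length_queries o pick V σ _ _)

theorem nextSkeleton_result {pick : Set (Dir d) → Dir d}
    (hpick : ∀ A : Set (Dir d), A.Nonempty → pick A ∈ A) {K : Complex d}
    (hK : GeneralPosition K.verts) {k : ℕ} (hk : 1 ≤ k) (hkd : k + 1 ≤ d) :
    (nextSkeleton pick K.verts (K.simplices.filter fun ρ => ρ.card = k)).result (heightsDims K) =
      K.simplices.filter fun ρ => ρ.card = k + 1 := by
  have hpairs : ∀ x : Finset (E d) × E d,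
      x ∈ ((K.simplices.filter fun ρ => ρ.card = k).toList.flatMap fun σ =>
        (K.verts \ σ).toList.map fun v => (σ, v)) ↔
      (x.1 ∈ K.simplices ∧ x.1.card = k) ∧ x.2 ∈ K.verts ∧ x.2 ∉ x.1 := by
    rintro ⟨σ, v⟩
    simp only [List.mem_flatMap, Finset.mem_toList, Finset.mem_filter, List.mem_map,
      Finset.mem_sdiff, Prod.mk.injEq]
    constructor
    · rintro ⟨σ', h1, v', h2, rfl, rfl⟩
      exact ⟨h1, h2⟩
    · rintro ⟨h1, h2⟩
      exact ⟨σ, h1, v, h2, rfl, rfl⟩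
  rw [nextSkeleton]
  generalize ((K.simplices.filter fun ρ => ρ.card = k).toList.flatMap fun σ =>
        (K.verts \ σ).toList.map fun v => (σ, v)) = l at hpairs ⊢
  have hinv := foldlM_invariant (heightsDims K)
    (fun (acc : Finset (Finset (E d))) (x : Finset (E d) × E d) => do
      let b ← isSimplex pick K.verts x.1 x.2
      return if b then insert (insert x.2 x.1) acc else acc)
    (fun pre acc => ∀ ρ, ρ ∈ acc ↔ ρ ∈ K.simplices ∧ ∃ x ∈ pre, insert x.2 x.1 = ρ)
    l ∅ (by simp) ?_
  · ext ρ
    rw [hinv, Finset.mem_filter]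
    refine and_congr_right fun hρ => ?_
    constructor
    · rintro ⟨x, hx, rfl⟩
      obtain ⟨⟨-, h1⟩, -, h2⟩ := (hpairs x).1 hx
      rw [Finset.card_insert_of_notMem h2, h1]
    · intro hc
      obtain ⟨v, hv⟩ := Complex.nonempty_of_mem hρ
      have hc' : (ρ.erase v).card = k := by
        rw [Finset.card_erase_of_mem hv, hc, Nat.add_sub_cancel]
      refine ⟨(ρ.erase v, v), (hpairs _).2 ⟨⟨?_, hc'⟩, Complex.subset_verts hρ hv, by simp⟩,
        Finset.insert_erase hv⟩
      exact Complex.mem_of_subset hρ (Finset.erase_subset _ _) (Finset.card_pos.1 (hc'.symm ▸ hk))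
  · rintro pre ⟨σ, v⟩ post acc hsplit hacc ρ
    obtain ⟨⟨h1, h2⟩, h3, h4⟩ := (hpairs (σ, v)).1 (by rw [hsplit]; simp)
    simp only at h1 h2 h3 h4
    simp only [result_bind, result_pure]
    rw [isSimplex_result hpick hK h1 (by omega) h3 h4]
    simp only [decide_eq_true_eq, List.mem_append, List.mem_singleton]
    split_ifs with h
    · rw [Finset.mem_insert, hacc]
      constructor
      · rintro (rfl | ⟨h5, x, h6, h7⟩)
        · exact ⟨h, _, Or.inr rfl, rfl⟩
        · exact ⟨h5, x, Or.inl h6, h7⟩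
      · rintro ⟨h5, x, h6 | rfl, h7⟩
        · exact Or.inr ⟨h5, x, h6, h7⟩
        · exact Or.inl h7.symm
    · rw [hacc]
      refine and_congr_right fun h5 => ⟨?_, ?_⟩
      · rintro ⟨x, h6, h7⟩
        exact ⟨x, Or.inl h6, h7⟩
      · rintro ⟨x, h6 | rfl, h7⟩
        · exact ⟨x, h6, h7⟩
        · exact absurd (h7 ▸ h5) h

theorem nextSkeleton_length_queries (o : Dir d → Multiset (ℝ × ℕ)) (pick : Set (Dir d) → Dir d)
    (V : Finset (E d)) {prev : Finset (Finset (E d))} {m : ℕ} (h : ∀ σ ∈ prev, σ.card ≤ m) :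
    ((nextSkeleton pick V prev).queries o).length ≤ prev.card * (V.card * (2 * 2 ^ m)) := by
  rw [nextSkeleton]
  refine (length_queries_foldlM_le o _ (2 * 2 ^ m) _ _ ?_).trans ?_
  · rintro ⟨σ, v⟩ hx acc
    rw [queries_bind, queries_pure, List.append_nil]
    refine (isSimplex_length_queries o pick V σ v).trans ?_
    simp only [List.mem_flatMap, Finset.mem_toList, List.mem_map, Prod.mk.injEq] at hx
    obtain ⟨σ', h1, v', -, rfl, rfl⟩ := hx
    exact Nat.mul_le_mul_left _ (Nat.pow_le_pow_right two_pos (h _ h1))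
  · rw [← mul_assoc prev.card]
    refine Nat.mul_le_mul_right _ ?_
    rw [List.length_flatMap]
    refine (List.sum_le_card_nsmul _ V.card ?_).trans (by simp)
    intro x hx
    obtain ⟨σ, -, rfl⟩ := List.mem_map.1 hx
    rw [List.length_map, Finset.length_toList]
    exact Finset.card_le_card Finset.sdiff_subset

/-! ### The full algorithm -/

section Full

variable {pick : Set (Dir d) → Dir d} {K : Complex d}

/-- The loop over the dimensions finds all simplices, with one round of queries for each
dimension. -/
theorem skeleta_spec (hpick : ∀ A : Set (Dir d), A.Nonempty → pick A ∈ A)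
    (hK : GeneralPosition K.verts) (hdim : K.dim < d) :
    let loop := (List.range' 2 (K.dim - 1)).foldlM (fun x _ => do
      let next ← nextSkeleton pick K.verts x.2
      return (x.1 ∪ next, next)) (K.verts.image (fun v => {v}) ∪
        K.simplices.filter fun ρ => ρ.card = 2, K.simplices.filter fun ρ => ρ.card = 2)
    (loop.result (heightsDims K)).1 = K.simplices ∧
      (loop.queries (heightsDims K)).length ≤
        K.simplices.card * (K.verts.card * (2 * 2 ^ K.dim)) := by
  intro loop
  have h0 : (K.verts.image (fun v => {v}) ∪ K.simplices.filter fun ρ => ρ.card = 2) =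
      K.simplices.filter fun ρ => ρ.card ≤ 2 := by
    ext ρ
    simp only [Finset.mem_union, Finset.mem_image, Finset.mem_filter]
    constructor
    · rintro (⟨v, hv, rfl⟩ | ⟨h1, h2⟩)
      · exact ⟨Complex.mem_verts.1 hv, by simp⟩
      · exact ⟨h1, h2.le⟩
    · rintro ⟨h1, h2⟩
      have := (Complex.nonempty_of_mem h1).card_pos
      rcases Nat.lt_or_ge ρ.card 2 with h3 | h3
      · obtain ⟨v, rfl⟩ := Finset.card_eq_one.1 (show ρ.card = 1 by omega)
        exact Or.inl ⟨v, Complex.mem_verts.2 h1, rfl⟩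
      · exact Or.inr ⟨h1, by omega⟩
  -- The loop body ignores `k`, but `k` is the cardinality of the simplices it starts from; `k ≤
  -- K.dim` keeps the new ones within `d` vertices.
  have hround : ∀ pre k post, List.range' 2 (K.dim - 1) = pre ++ k :: post →
      k = pre.length + 2 ∧ k ≤ K.dim := by
    intro pre k post h
    have h1 := congrArg (fun l : List ℕ => l[pre.length]?) h
    have h2 : pre.length < K.dim - 1 := by
      have := congrArg List.length h
      simp only [List.length_range', List.length_append, List.length_cons] at this
      omega
    simp only [List.getElem?_range' h2, List.getElem?_append_right le_rfl, Nat.sub_self,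
      List.getElem?_cons_zero, Option.some.injEq] at h1
    omega
  have hstep : ∀ pre k post (x : Finset (Finset (E d)) × Finset (Finset (E d))),
      List.range' 2 (K.dim - 1) = pre ++ k :: post →
      x = (K.simplices.filter fun ρ => ρ.card ≤ pre.length + 2,
        K.simplices.filter fun ρ => ρ.card = pre.length + 2) →
      (do
        let next ← nextSkeleton pick K.verts x.2
        return (x.1 ∪ next, next) : DirProg d _).result (heightsDims K) =
        (K.simplices.filter fun ρ => ρ.card ≤ (pre ++ [k]).length + 2,
          K.simplices.filter fun ρ => ρ.card = (pre ++ [k]).length + 2) := by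
    rintro pre k post x h rfl
    obtain ⟨h1, h2⟩ := hround pre k post h
    simp only [result_bind, result_pure]
    rw [nextSkeleton_result hpick hK (by omega) (by omega), List.length_append,
      List.length_singleton]
    refine Prod.ext ?_ (Finset.filter_congr fun ρ _ => by omega)
    simp only
    rw [← Finset.filter_or]
    exact Finset.filter_congr fun ρ _ => by omega
  constructor
  · have := foldlM_invariant (heightsDims K) _
      (fun (pre : List ℕ) x => x = (K.simplices.filter fun ρ => ρ.card ≤ pre.length + 2,
        K.simplices.filter fun ρ => ρ.card = pre.length + 2))
      (List.range' 2 (K.dim - 1)) (K.verts.image (fun v => {v}) ∪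
        K.simplices.filter fun ρ => ρ.card = 2, K.simplices.filter fun ρ => ρ.card = 2)
      (by rw [h0]; rfl) hstep
    rw [this]
    refine Finset.filter_true_of_mem fun ρ hρ => ?_
    have := Complex.card_le_dim hρ
    -- With truncated subtraction, `K.dim - 1 + 2` is at least `K.dim + 1` also in dimension `0`.
    rw [List.length_range']
    omega
  · have := length_queries_foldlM_le_sum (heightsDims K) _
      (fun (pre : List ℕ) x => x = (K.simplices.filter fun ρ => ρ.card ≤ pre.length + 2,
        K.simplices.filter fun ρ => ρ.card = pre.length + 2))
      (fun k => (K.simplices.filter fun ρ => ρ.card = k).card *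
        (K.verts.card * (2 * 2 ^ K.dim)))
      (List.range' 2 (K.dim - 1)) (K.verts.image (fun v => {v}) ∪
        K.simplices.filter fun ρ => ρ.card = 2, K.simplices.filter fun ρ => ρ.card = 2)
      (by rw [h0]; rfl) (fun pre k post x h hx =>
        ⟨hstep pre k post x h hx, by
          obtain ⟨h1, h2⟩ := hround pre k post h
          rw [queries_bind, queries_pure, List.append_nil, hx, h1]
          exact nextSkeleton_length_queries _ _ _ fun σ hσ => by
            rw [(Finset.mem_filter.1 hσ).2]; omega⟩)
    refine this.trans ?_
    rw [List.sum_map_mul_right]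
    refine Nat.mul_le_mul_right _ ?_
    rw [← List.sum_toFinset _ List.nodup_range', ← Finset.card_biUnion]
    · exact Finset.card_le_card (Finset.biUnion_subset.2 fun k _ => Finset.filter_subset _ _)
    · intro i _ j _ hij
      exact Finset.disjoint_filter.2 fun ρ _ h1 h2 => hij (h1.symm.trans h2)

theorem reconstruct_result (hd : 2 ≤ d) (hpick : ∀ A : Set (Dir d), A.Nonempty → pick A ∈ A)
    (hK : GeneralPosition K.verts) (hdim : K.dim < d) :
    (reconstruct pick).result (heightsDims K) = K.simplices := by
  simp only [reconstruct, result_bind, result_pure, findVerts_result hK.injective,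
    findEdges_result hd hpick hK, toFinset_sortedVerts]
  exact (skeleta_spec hpick hK hdim).1

/-- With `n₀` vertices, `n` simplices and dimension `κ`, the stages cost at most `2d + 1`, `1 +
2n₀²` and `2 · 2^κ n n₀` queries. Since `n₀ ≤ n`, the factor `4` absorbs all. -/
theorem reconstruct_length_queries (hd : 2 ≤ d)
    (hpick : ∀ A : Set (Dir d), A.Nonempty → pick A ∈ A)
    (hK : GeneralPosition K.verts) (hdim : K.dim < d) :
    ((reconstruct pick).queries (heightsDims K)).length ≤
      4 * (d + 2 ^ K.dim * K.simplices.card * K.verts.card) := by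
  simp only [reconstruct, queries_bind, queries_pure, findVerts_result hK.injective,
    findEdges_result hd hpick hK, toFinset_sortedVerts, List.append_nil, List.length_append]
  have h1 := findVerts_length_queries (heightsDims K)
  have h2 := findEdges_length_queries (heightsDims K) pick K.verts
  have h3 := (skeleta_spec hpick hK hdim).2
  have h4 : K.verts.card * (2 * K.verts.card) ≤
      2 * (2 ^ K.dim * K.simplices.card * K.verts.card) := by
    have := Nat.mul_le_mul_right K.verts.card
      (Nat.mul_le_mul (Nat.one_le_two_pow (n := K.dim)) (Complex.card_verts_le (K := K)))
    linarith
  have h5 : K.simplices.card * (K.verts.card * (2 * 2 ^ K.dim)) =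
      2 * (2 ^ K.dim * K.simplices.card * K.verts.card) := by ring
  rw [h5] at h3
  refine (Nat.add_le_add h1 (Nat.add_le_add h2 h3)).trans ?_
  omega

/-- The answers to the queries determine the complex. -/
theorem eq_of_answers (hd : 2 ≤ d) (hpick : ∀ A : Set (Dir d), A.Nonempty → pick A ∈ A)
    (hK : GeneralPosition K.verts) (hdim : K.dim < d) {K' : Complex d}
    (h : ∀ s ∈ (reconstruct pick).queries (heightsDims K), heightsDims K' s = heightsDims K s) :
    K' = K := by
  have hverts : K'.verts = K.verts := verts_eq_of_answers hK.injective fun s hs =>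
    h s (by rw [reconstruct, queries_bind]; exact List.mem_append_left _ hs)
  have hK' : GeneralPosition K'.verts := hverts ▸ hK
  have hdim' : K'.dim = K.dim := by
    have := result_congr (findVerts : DirProg d _) fun s hs =>
      h s (by rw [reconstruct, queries_bind]; exact List.mem_append_left _ hs)
    rw [findVerts_result hK.injective, findVerts_result hK'.injective] at this
    exact (Prod.mk.inj this).2
  apply Complex.ext_simplices
  rw [← reconstruct_result hd hpick hK hdim, ← reconstruct_result hd hpick hK' (hdim' ▸ hdim)]
  exact result_congr _ h

end Full

end DirectionalTransform

namespace DirectionalTransform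

/-! ### Betti numbers when a simplex is added -/

section Homology

variable (F : Type*) [Field F] {V : Type*}

theorem boundary_single (σ : Finset V) (a : F) :
    boundary F (Finsupp.single σ a) = a • ∑ v ∈ σ,
      if (σ.erase v).Nonempty then
        Finsupp.single (σ.erase v) ((-1 : F) ^ (σ.filter fun u => WellOrderingRel u v).card)
      else 0 :=
  Finsupp.linearCombination_single _ _ _

/-- Erasing the earlier vertex `v` lowers the position of `w` by one, while erasing `w` does not
move `v`; the two orders of removal get opposite signs. -/
theorem filter_erase_sign {σ : Finset V} {v w : V} (hv : v ∈ σ) (h : WellOrderingRel v w) :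
    (-1 : F) ^ ((σ.filter fun u => WellOrderingRel u v).card) *
        (-1) ^ (((σ.erase v).filter fun u => WellOrderingRel u w).card) +
      (-1 : F) ^ ((σ.filter fun u => WellOrderingRel u w).card) *
        (-1) ^ (((σ.erase w).filter fun u => WellOrderingRel u v).card) = 0 := by
  have h1 : (σ.erase w).filter (fun u => WellOrderingRel u v) =
      σ.filter fun u => WellOrderingRel u v := by
    rw [Finset.filter_erase, Finset.erase_eq_of_notMem]
    exact fun h' => asymm_of WellOrderingRel h (Finset.mem_filter.1 h').2
  have h2 : ((σ.erase v).filter fun u => WellOrderingRel u w).card + 1 =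
      (σ.filter fun u => WellOrderingRel u w).card := by
    rw [Finset.filter_erase]
    exact Finset.card_erase_add_one (Finset.mem_filter.2 ⟨hv, h⟩)
  rw [h1, ← h2, pow_succ]
  ring

theorem boundary_boundary (x : Finset V →₀ F) : boundary F (boundary F x) = 0 := by
  suffices h : (boundary F).comp (boundary F) = (0 : (Finset V →₀ F) →ₗ[F] (Finset V →₀ F)) from
    LinearMap.congr_fun h x
  refine Finsupp.lhom_ext fun σ a => ?_
  rw [LinearMap.comp_apply, boundary_single, map_smul, map_sum, LinearMap.zero_apply]
  refine smul_eq_zero_of_right _ ?_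
  let g : V → V → (Finset V →₀ F) := fun v w =>
    if ((σ.erase v).erase w).Nonempty then
      Finsupp.single ((σ.erase v).erase w)
        ((-1 : F) ^ ((σ.filter fun u => WellOrderingRel u v).card) *
          (-1) ^ (((σ.erase v).filter fun u => WellOrderingRel u w).card))
    else 0
  have h1 : ∀ v ∈ σ, boundary F (if (σ.erase v).Nonempty then
      Finsupp.single (σ.erase v) ((-1 : F) ^ (σ.filter fun u => WellOrderingRel u v).card)
      else 0) = ∑ w ∈ σ.erase v, g v w := by
    intro v _
    split_ifs with h
    · rw [boundary_single, Finset.smul_sum]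
      refine Finset.sum_congr rfl fun w _ => ?_
      simp only [g]
      split_ifs
      · rw [Finsupp.smul_single, smul_eq_mul]
      · rw [smul_zero]
    · rw [Finset.not_nonempty_iff_eq_empty.1 h, map_zero, Finset.sum_empty]
  rw [Finset.sum_congr rfl h1, Finset.sum_sigma']
  -- Exchanging the two removed vertices pairs off cancelling terms.
  refine Finset.sum_involution (fun x _ => ⟨x.2, x.1⟩) ?_ ?_ ?_ ?_
  · rintro ⟨v, w⟩ hx
    obtain ⟨hv, hw⟩ := Finset.mem_sigma.1 hx
    obtain ⟨hwv, hw⟩ := Finset.mem_erase.1 hw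
    simp only [g]
    rw [Finset.erase_right_comm]
    split_ifs
    · rw [← Finsupp.single_add]
      rcases trichotomous_of WellOrderingRel v w with h | h | h
      · rw [filter_erase_sign F hv h, Finsupp.single_zero]
      · exact absurd h.symm hwv
      · rw [add_comm, filter_erase_sign F hw h, Finsupp.single_zero]
    · rw [add_zero]
  · rintro ⟨v, w⟩ hx _ h
    exact (Finset.mem_erase.1 (Finset.mem_sigma.1 hx).2).1 (congrArg Sigma.fst h)
  · rintro ⟨v, w⟩ hx
    obtain ⟨hv, hw⟩ := Finset.mem_sigma.1 hx
    obtain ⟨hwv, hw⟩ := Finset.mem_erase.1 hw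
    exact Finset.mem_sigma.2 ⟨hw, Finset.mem_erase.2 ⟨fun h => hwv h.symm, hv⟩⟩
  · rintro ⟨v, w⟩ _
    rfl

theorem chains_eq_span (L : Set (Finset V)) (k : ℕ) :
    chains F L k = Submodule.span F
      ((fun σ => Finsupp.single σ 1) '' {σ | σ ∈ L ∧ σ.card = k + 1}) :=
  Finsupp.supported_eq_span_single _ _

theorem chains_mono {L L' : Set (Finset V)} (h : L ⊆ L') (k : ℕ) :
    chains F L k ≤ chains F L' k :=
  Finsupp.supported_mono fun _ hσ => ⟨h hσ.1, hσ.2⟩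

/-- The rank of the boundary map on the `k`-chains. -/
def boundaryRank (L : Set (Finset V)) (k : ℕ) : ℕ :=
  Module.finrank F ((chains F L k).map (boundary F))

/-- Homology is unreduced, so adding a vertex always raises `β_0`; this is what the case `m = 0` of
`betti_insert` needs. -/
theorem boundaryRank_zero (L : Set (Finset V)) : boundaryRank F L 0 = 0 := by
  have h : (chains F L 0).map (boundary F) = ⊥ := by
    rw [chains_eq_span, Submodule.map_span, Submodule.span_eq_bot]
    rintro _ ⟨_, ⟨σ, ⟨-, hσ⟩, rfl⟩, rfl⟩
    obtain ⟨v, rfl⟩ := Finset.card_eq_one.1 (by simpa using hσ)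
    simp [boundary_single]
  rw [boundaryRank, h, finrank_bot]

variable {F} {L : Set (Finset V)}

theorem finiteDimensional_chains (hL : L.Finite) (k : ℕ) : FiniteDimensional F (chains F L k) := by
  rw [chains_eq_span]
  exact FiniteDimensional.span_of_finite F ((hL.subset fun _ h => h.1).image _)

theorem finrank_chains (hL : L.Finite) (k : ℕ) :
    Module.finrank F (chains F L k) = {σ | σ ∈ L ∧ σ.card = k + 1}.ncard := by
  have hf : {σ | σ ∈ L ∧ σ.card = k + 1}.Finite := hL.subset fun _ h => h.1
  have := hf.fintype
  rw [chains, (Finsupp.supportedEquivFinsupp _).finrank_eq, Module.finrank_finsupp_self,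
    ← Nat.card_eq_fintype_card]
  rfl

theorem finrank_cycles_add (hL : L.Finite) (k : ℕ) :
    Module.finrank F (cycles F L k) + boundaryRank F L k =
      {σ | σ ∈ L ∧ σ.card = k + 1}.ncard := by
  have := finiteDimensional_chains (F := F) hL k
  have h := LinearMap.finrank_range_add_finrank_ker (K := F) (V := chains F L k)
    (V₂ := Finset V →₀ F) ((boundary F).domRestrict (chains F L k))
  rw [LinearMap.range_domRestrict, ← Submodule.finrank_map_subtype_eq, LinearMap.ker_domRestrict,
    Submodule.map_comap_subtype, add_comm] at h
  rw [← finrank_chains (F := F) hL k]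
  exact h

theorem boundaries_le_cycles (hL : ∀ σ ∈ L, ∀ τ ⊆ σ, τ.Nonempty → τ ∈ L) (k : ℕ) :
    boundaries F L k ≤ cycles F L k := by
  refine le_inf ?_ ?_
  · rw [boundaries, chains_eq_span, Submodule.map_span, Submodule.span_le]
    rintro _ ⟨_, ⟨σ, ⟨hσ, hcard⟩, rfl⟩, rfl⟩
    simp only [SetLike.mem_coe]
    rw [boundary_single, one_smul]
    refine Submodule.sum_mem _ fun v hv => ?_
    split_ifs with h
    · refine Finsupp.single_mem_supported F _ ⟨hL σ hσ _ (Finset.erase_subset _ _) h, ?_⟩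
      rw [Finset.card_erase_of_mem hv, hcard, Nat.add_sub_cancel]
    · exact Submodule.zero_mem _
  · rintro _ ⟨x, -, rfl⟩
    exact boundary_boundary F x

/-- Rank-nullity for the boundary map. Closure under faces puts boundaries among the cycles, so the
truncated subtraction in `betti` is exact. -/
theorem betti_eq (hfin : L.Finite) (hL : ∀ σ ∈ L, ∀ τ ⊆ σ, τ.Nonempty → τ ∈ L) (k : ℕ) :
    (betti F L k : ℤ) = {σ | σ ∈ L ∧ σ.card = k + 1}.ncard - boundaryRank F L k -
      boundaryRank F L (k + 1) := by
  have := finiteDimensional_chains (F := F) hfin k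
  have hfd : FiniteDimensional F (cycles F L k) := Submodule.finiteDimensional_inf_left _ _
  have hle : Module.finrank F (boundaries F L k) ≤ Module.finrank F (cycles F L k) :=
    Submodule.finrank_mono (boundaries_le_cycles hL k)
  have hadd := finrank_cycles_add (F := F) hfin k
  have hb : Module.finrank F (boundaries F L k) = boundaryRank F L (k + 1) := rfl
  rw [hb] at hle
  rw [betti, hb]
  omega

/-- Adding a simplex of dimension `m` either creates a cycle in dimension `m` or, if `m ≠ 0`,
kills one in dimension `m - 1`. -/
theorem betti_insert {σ : Finset V} {m : ℕ} (hσ : σ ∉ L) (hcard : σ.card = m + 1)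
    (hfin : L.Finite) (hL : ∀ σ ∈ L, ∀ τ ⊆ σ, τ.Nonempty → τ ∈ L)
    (hL' : ∀ ρ ∈ insert σ L, ∀ τ ⊆ ρ, τ.Nonempty → τ ∈ insert σ L) :
    ∃ e : ℤ, (e = 0 ∨ e = 1) ∧ (m = 0 → e = 0) ∧ ∀ k,
      (betti F (insert σ L) k : ℤ) - betti F L k =
        (if k = m then 1 - e else 0) - if k + 1 = m then e else 0 := by
  have hfin' : (insert σ L).Finite := hfin.insert σ
  have hset : ∀ k, k ≠ m → {ρ | ρ ∈ insert σ L ∧ ρ.card = k + 1} =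
      {ρ | ρ ∈ L ∧ ρ.card = k + 1} := by
    intro k hk
    ext ρ
    simp only [Set.mem_ofPred_eq, Set.mem_insert_iff]
    constructor
    · rintro ⟨rfl | h1, h2⟩
      · omega
      · exact ⟨h1, h2⟩
    · exact fun h => ⟨Or.inr h.1, h.2⟩
  have hsetm : {ρ | ρ ∈ insert σ L ∧ ρ.card = m + 1} =
      insert σ {ρ | ρ ∈ L ∧ ρ.card = m + 1} := by
    ext ρ
    simp only [Set.mem_ofPred_eq, Set.mem_insert_iff]
    constructor
    · rintro ⟨rfl | h1, h2⟩
      · exact Or.inl rfl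
      · exact Or.inr ⟨h1, h2⟩
    · rintro (rfl | h)
      · exact ⟨Or.inl rfl, hcard⟩
      · exact ⟨Or.inr h.1, h.2⟩
  have hncard : {ρ | ρ ∈ insert σ L ∧ ρ.card = m + 1}.ncard =
      {ρ | ρ ∈ L ∧ ρ.card = m + 1}.ncard + 1 := by
    rw [hsetm, Set.ncard_insert_of_notMem (fun h => hσ h.1) (hfin.subset fun _ h => h.1)]
  have hrank : ∀ k, k ≠ m → boundaryRank F (insert σ L) k = boundaryRank F L k := by
    intro k hk
    rw [boundaryRank, boundaryRank, chains, chains, hset k hk]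
  have hfd := finiteDimensional_chains (F := F) hfin m
  have hfd' := finiteDimensional_chains (F := F) hfin' m
  have hrank1 : boundaryRank F L m ≤ boundaryRank F (insert σ L) m :=
    Submodule.finrank_mono (Submodule.map_mono (chains_mono F (Set.subset_insert _ _) m))
  have hrank2 : boundaryRank F (insert σ L) m ≤ boundaryRank F L m + 1 := by
    rw [boundaryRank, chains_eq_span, hsetm, Set.image_insert_eq, Submodule.span_insert,
      ← chains_eq_span, Submodule.map_sup, sup_comm, Submodule.map_span, Set.image_singleton]
    refine (Submodule.finrank_add_le_finrank_add_finrank _ _).trans (Nat.add_le_add_left ?_ _)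
    exact (finrank_span_le_card _).trans (by simp)
  have hrank0 : m = 0 → boundaryRank F (insert σ L) m = boundaryRank F L m := by
    rintro rfl
    rw [boundaryRank_zero, boundaryRank_zero]
  -- Only the number of `m`-simplices and the rank of the boundary map in degree `m` change. The
  -- witness is the increase of this rank: `0` if `σ` creates a cycle, `1` if it kills one.
  refine ⟨(boundaryRank F (insert σ L) m : ℤ) - boundaryRank F L m, by omega, fun h => by
    rw [hrank0 h, sub_self], fun k => ?_⟩
  rw [betti_eq hfin hL, betti_eq hfin' hL']
  by_cases h1 : k = m
  · subst h1
    rw [if_pos rfl, if_neg (by omega), hncard, hrank (k + 1) (by omega)]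
    push_cast
    ring
  · rw [if_neg h1, hset k h1, hrank k h1]
    by_cases h2 : k + 1 = m
    · subst h2
      rw [if_pos rfl]
      ring
    · rw [if_neg h2, hrank (k + 1) h2]
      ring

theorem betti_empty (k : ℕ) : betti F (∅ : Set (Finset V)) k = 0 := by
  have h := betti_eq (F := F) (L := (∅ : Set (Finset V))) Set.finite_empty
    (fun _ h => absurd h (Set.notMem_empty _)) k
  simp only [Set.mem_empty_iff_false, false_and, Set.ofPred_false, Set.ncard_empty] at h
  omega

end Homology

/-! ### Augmented Betti curves determine the heights and dimensions -/

variable {d : ℕ}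

namespace IndexFiltration

variable {K : Complex d} {s : Dir d} (I : IndexFiltration K s)

/-- The set of the first `j` simplices. -/
def initial (j : ℕ) : Set (Finset (E d)) := {σ | σ ∈ I.order.take j}

theorem mem_simplices_of_mem_initial {j : ℕ} {σ : Finset (E d)} (h : σ ∈ I.initial j) :
    σ ∈ K.simplices :=
  (I.mem_order σ).1 (List.mem_of_mem_take h)

theorem initial_closed (j : ℕ) :
    ∀ σ ∈ I.initial j, ∀ τ ⊆ σ, τ.Nonempty → τ ∈ I.initial j := by
  intro σ hσ τ hτ hne
  have h1 : τ ∈ I.order := (I.mem_order τ).2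
    (Complex.mem_of_subset (I.mem_simplices_of_mem_initial hσ) hτ hne)
  have hc := I.compatible
  rw [← List.take_append_drop j I.order] at h1 hc
  refine (List.mem_append.1 h1).resolve_right fun h => ?_
  exact ((List.pairwise_append.1 hc).2.2 σ hσ τ h).2 hτ

theorem initial_finite (j : ℕ) : (I.initial j).Finite := List.finite_toSet _

theorem initial_succ (i : Fin I.order.length) :
    I.initial (i + 1) = insert (I.order.get i) (I.initial i) := by
  ext σ
  rw [Set.mem_insert_iff, or_comm]
  change σ ∈ I.order.take (i + 1) ↔ σ ∈ I.order.take i ∨ _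
  rw [List.take_succ_eq_append_getElem i.2, List.mem_append, List.mem_singleton]
  rfl

theorem get_notMem_initial (i : Fin I.order.length) : I.order.get i ∉ I.initial i := by
  intro h
  have hn := I.nodup
  rw [← List.take_append_drop i I.order] at hn
  refine (List.nodup_append.1 hn).2.2 _ h _ ?_ rfl
  rw [List.drop_eq_getElem_cons i.2]
  exact List.mem_cons_self

theorem get_mem_simplices (i : Fin I.order.length) : I.order.get i ∈ K.simplices :=
  (I.mem_order _).1 (List.get_mem _ _)

/-- The sublevel sets of the height are initial parts of the filtration. -/
theorem exists_initial_eq (p : ℝ) : ∃ j ≤ I.order.length,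
    {σ | σ ∈ K.simplices ∧ height s σ ≤ p} = I.initial j ∧
      ∀ i : Fin I.order.length, height s (I.order.get i) ≤ p ↔ (i : ℕ) < j := by
  have hsorted : ∀ i i' : Fin I.order.length, i < i' →
      height s (I.order.get i) ≤ height s (I.order.get i') :=
    fun i i' h => (List.pairwise_iff_get.1 I.compatible i i' h).1
  have hex : ∃ j ≤ I.order.length,
      ∀ i : Fin I.order.length, height s (I.order.get i) ≤ p ↔ (i : ℕ) < j := by
    by_cases h : ∃ j, ∃ hj : j < I.order.length, p < height s (I.order.get ⟨j, hj⟩)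
    · refine ⟨Nat.find h, (Nat.find_spec h).1.le, fun i => ⟨fun hi => ?_, fun hi => ?_⟩⟩
      · by_contra! hle
        obtain ⟨h1, h2⟩ := Nat.find_spec h
        rcases hle.eq_or_lt with heq | hlt
        · have : (⟨Nat.find h, h1⟩ : Fin I.order.length) = i := Fin.ext heq
          rw [this] at h2
          exact hi.not_gt h2
        · exact (h2.trans_le (hsorted ⟨Nat.find h, h1⟩ i hlt)).not_ge hi
      · by_contra! hgt
        exact Nat.find_min h hi ⟨i.2, hgt⟩
    · push Not at h
      exact ⟨_, le_rfl, fun i => iff_of_true (h i i.2) i.2⟩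
  obtain ⟨j, hj, hiff⟩ := hex
  refine ⟨j, hj, ?_, hiff⟩
  ext σ
  rw [Set.mem_ofPred_eq, initial, Set.mem_ofPred_eq, List.mem_take_iff_getElem, ← I.mem_order]
  constructor
  · rintro ⟨h1, h2⟩
    obtain ⟨i, rfl⟩ := List.get_of_mem h1
    exact ⟨i, lt_min ((hiff i).1 h2) i.2, rfl⟩
  · rintro ⟨i, hi, rfl⟩
    have hi' := hi.trans_le (min_le_right _ _)
    exact ⟨List.getElem_mem _, (hiff ⟨i, hi'⟩).2 (hi.trans_le (min_le_left _ _))⟩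

variable (F : Type*) [Field F]

/-- A sublevel set is an initial part of the filtration, so its Betti number telescopes. The next
two lemmas sum over the same indices, which permits a comparison term by term. -/
theorem betti_sublevel (k : ℕ) (p : ℝ) :
    (betti F {σ | σ ∈ K.simplices ∧ height s σ ≤ p} k : ℤ) =
      ∑ i : Fin I.order.length, if height s (I.order.get i) ≤ p then
        (betti F (I.initial (i + 1)) k : ℤ) - betti F (I.initial i) k else 0 := by
  obtain ⟨j, hj, hset, hiff⟩ := I.exists_initial_eq p
  simp only [hiff]
  rw [hset, Fin.sum_univ_eq_sum_range (fun i => if i < j then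
    (betti F (I.initial (i + 1)) k : ℤ) - betti F (I.initial i) k else 0),
    ← Finset.sum_filter]
  have : (Finset.range I.order.length).filter (fun i => i < j) = Finset.range j := by
    ext i
    simp only [Finset.mem_filter, Finset.mem_range]
    omega
  rw [this, Finset.sum_range_sub (fun i => (betti F (I.initial i) k : ℤ))]
  have h0 : I.initial 0 = ∅ := by
    ext; simp [initial]
  rw [h0, betti_empty, Nat.cast_zero, sub_zero]

theorem countP_augBettiCurve (k : ℕ) (p : ℝ) :
    (((augBettiCurve F I k).2.countP fun x => x.1 ≤ p : ℕ) : ℤ) =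
      ∑ i : Fin I.order.length, if height s (I.order.get i) ≤ p then
        (if betti F (I.initial (i + 1)) k ≠ betti F (I.initial i) k then (1 : ℤ) else 0)
        else 0 := by
  have h : (augBettiCurve F I k).2.countP (fun x => x.1 ≤ p) =
      ((Finset.univ.filter fun i : Fin I.order.length =>
        betti F (I.initial (i + 1)) k ≠ betti F (I.initial i) k).filter fun i =>
          height s (I.order.get i) ≤ p).card := by
    simp only [augBettiCurve]
    rw [Multiset.countP_map]
    rfl
  rw [h, Finset.filter_filter, Finset.card_filter, Nat.cast_sum]
  refine Finset.sum_congr rfl fun i _ => ?_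
  rw [← ite_and, Nat.cast_ite, Nat.cast_one, Nat.cast_zero]
  exact if_congr and_comm rfl rfl

theorem card_filter_simplices (k : ℕ) (p : ℝ) :
    ((K.simplices.filter fun σ => σ.card = k + 1 ∧ height s σ ≤ p).card : ℤ) =
      ∑ i : Fin I.order.length, if height s (I.order.get i) ≤ p then
        (if (I.order.get i).card = k + 1 then (1 : ℤ) else 0) else 0 := by
  have h : (K.simplices.filter fun σ => σ.card = k + 1 ∧ height s σ ≤ p) =
      (Finset.univ.filter fun i : Fin I.order.length => (I.order.get i).card = k + 1 ∧
        height s (I.order.get i) ≤ p).image I.order.get := by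
    ext σ
    simp only [Finset.mem_filter, Finset.mem_image, Finset.mem_univ, true_and]
    constructor
    · rintro ⟨h1, h2⟩
      obtain ⟨i, rfl⟩ := List.get_of_mem ((I.mem_order σ).2 h1)
      exact ⟨i, h2, rfl⟩
    · rintro ⟨i, h, rfl⟩
      exact ⟨I.get_mem_simplices i, h⟩
  rw [h, Finset.card_image_of_injective _ (List.nodup_iff_injective_get.1 I.nodup),
    Finset.card_filter, Nat.cast_sum]
  refine Finset.sum_congr rfl fun i _ => ?_
  rw [← ite_and, Nat.cast_ite, Nat.cast_one, Nat.cast_zero]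
  exact if_congr and_comm rfl rfl

theorem exists_betti_step (i : Fin I.order.length) :
    ∃ e : ℤ, (e = 0 ∨ e = 1) ∧ ((I.order.get i).card = 1 → e = 0) ∧ ∀ k,
      (betti F (I.initial (i + 1)) k : ℤ) - betti F (I.initial i) k =
        (if (I.order.get i).card = k + 1 then 1 - e else 0) -
          if (I.order.get i).card = k + 2 then e else 0 := by
  have hpos := (Complex.nonempty_of_mem (I.get_mem_simplices i)).card_pos
  obtain ⟨m, hm⟩ := Nat.exists_eq_add_of_lt hpos
  rw [Nat.zero_add] at hm
  have hL' := I.initial_closed (i + 1)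
  rw [I.initial_succ] at hL' ⊢
  obtain ⟨e, h1, h2, h3⟩ := betti_insert (F := F) (I.get_notMem_initial i) hm
    (I.initial_finite i) (I.initial_closed i) hL'
  refine ⟨e, h1, fun h => h2 (by omega), fun k => ?_⟩
  rw [h3 k, hm]
  congr 1
  · exact if_congr (by omega) rfl rfl
  · exact if_congr (by omega) rfl rfl

/-- The number of `k`-simplices up to a height in terms of the augmented Betti curves. -/
theorem two_mul_card_filter (k : ℕ) (p : ℝ) :
    2 * ((K.simplices.filter fun σ => σ.card = k + 1 ∧ height s σ ≤ p).card : ℤ) =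
      ((augBettiCurve F I k).2.countP fun x => x.1 ≤ p : ℕ) + (augBettiCurve F I k).1 p +
      if k = 0 then 0 else
        ((augBettiCurve F I (k - 1)).2.countP fun x => x.1 ≤ p : ℕ) -
          ((augBettiCurve F I (k - 1)).1 p : ℤ) := by
  have hB : ∀ k, ((augBettiCurve F I k).1 p : ℤ) = _ := fun k => I.betti_sublevel F k p
  rw [hB k, hB (k - 1), I.countP_augBettiCurve, I.countP_augBettiCurve, I.card_filter_simplices,
    ← Finset.sum_add_distrib, ← Finset.sum_sub_distrib, Finset.mul_sum]
  -- For a change `δ` in `{-1, 0, 1}`, `[δ ≠ 0] + δ` is twice the indicator of a rise and `[δ ≠ 0] -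
  -- δ` twice that of a fall. A simplex has dimension `k` iff it makes `β_k` rise or `β_(k-1)` fall,
  -- and never does both.
  have hterm : ∀ i : Fin I.order.length,
      2 * (if height s (I.order.get i) ≤ p then
        (if (I.order.get i).card = k + 1 then (1 : ℤ) else 0) else 0) =
      ((if height s (I.order.get i) ≤ p then
        (if betti F (I.initial (i + 1)) k ≠ betti F (I.initial i) k then (1 : ℤ) else 0)
        else 0) + if height s (I.order.get i) ≤ p then
        (betti F (I.initial (i + 1)) k : ℤ) - betti F (I.initial i) k else 0) +
      if k = 0 then 0 else
      ((if height s (I.order.get i) ≤ p then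
        (if betti F (I.initial (i + 1)) (k - 1) ≠ betti F (I.initial i) (k - 1) then (1 : ℤ)
          else 0) else 0) - if height s (I.order.get i) ≤ p then
        (betti F (I.initial (i + 1)) (k - 1) : ℤ) - betti F (I.initial i) (k - 1) else 0) := by
    intro i
    by_cases hp : height s (I.order.get i) ≤ p
    · simp only [if_pos hp]
      obtain ⟨e, h1, h2, h3⟩ := I.exists_betti_step F i
      have hk := h3 k
      have hk1 := h3 (k - 1)
      generalize (I.order.get i).card = c at *
      generalize betti F (I.initial (i + 1)) k = x at *
      generalize betti F (I.initial i) k = y at *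
      generalize betti F (I.initial (i + 1)) (k - 1) = x' at *
      generalize betti F (I.initial i) (k - 1) = y' at *
      split_ifs at * <;> omega
    · simp only [if_neg hp]
      simp
  rw [Finset.sum_congr rfl fun i _ => hterm i, Finset.sum_add_distrib]
  congr 1
  split_ifs <;> simp

end IndexFiltration

/-- There are finitely many heights, so some `p < c` has no height of either complex strictly
between `p` and `c`; the count at `c` is the difference of the counts up to `c` and up to `p`. -/
theorem heightsDims_eq_of_cumulative {K K' : Complex d} {s : Dir d}
    (h : ∀ (k : ℕ) (p : ℝ),
      (K.simplices.filter fun σ => σ.card = k + 1 ∧ height s σ ≤ p).card =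
        (K'.simplices.filter fun σ => σ.card = k + 1 ∧ height s σ ≤ p).card) :
    heightsDims K s = heightsDims K' s := by
  refine Multiset.ext.2 fun ⟨c, k⟩ => ?_
  change simplexCount _ k c = simplexCount _ k c
  rw [simplexCount_heightsDims, simplexCount_heightsDims]
  obtain ⟨p, hpc, hp⟩ : ∃ p < c, ∀ σ ∈ K.simplices ∪ K'.simplices,
      height s σ < c → height s σ ≤ p := by
    generalize K.simplices ∪ K'.simplices = A
    induction A using Finset.induction_on with
    | empty => exact ⟨c - 1, by linarith, by simp⟩
    | insert σ A _ ih =>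
      obtain ⟨p, h1, h2⟩ := ih
      by_cases hσ : height s σ < c
      · refine ⟨max p (height s σ), max_lt h1 hσ, fun τ hτ h3 => ?_⟩
        rcases Finset.mem_insert.1 hτ with rfl | hτ
        · exact le_max_right _ _
        · exact (h2 τ hτ h3).trans (le_max_left _ _)
      · refine ⟨p, h1, fun τ hτ h3 => ?_⟩
        rcases Finset.mem_insert.1 hτ with rfl | hτ
        · exact absurd h3 hσ
        · exact h2 τ hτ h3
  have key : ∀ L : Complex d, (∀ σ ∈ L.simplices, height s σ < c → height s σ ≤ p) →
      (L.simplices.filter fun σ => σ.card = k + 1 ∧ height s σ = c).card +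
        (L.simplices.filter fun σ => σ.card = k + 1 ∧ height s σ ≤ p).card =
        (L.simplices.filter fun σ => σ.card = k + 1 ∧ height s σ ≤ c).card := by
    intro L hL
    rw [← Finset.card_union_of_disjoint, ← Finset.filter_or]
    · congr 1
      refine Finset.filter_congr fun σ hσ => ?_
      rw [← and_or_left]
      refine and_congr_right fun _ => ⟨?_, fun h => ?_⟩
      · rintro (h | h)
        · exact h.le
        · exact h.trans hpc.le
      · exact h.eq_or_lt.imp_right (hL σ hσ)
    · refine Finset.disjoint_filter.2 fun σ _ h1 h2 => ?_
      rw [h1.2] at h2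
      exact hpc.not_ge h2.2
  have h1 := key K fun σ hσ => hp σ (Finset.mem_union_left _ hσ)
  have h2 := key K' fun σ hσ => hp σ (Finset.mem_union_right _ hσ)
  rw [h k p, h k c] at h1
  omega

/-- The counting formula holds for every compatible filtration, so it does not matter which ones
witness the equality of the curves. -/
theorem SameBettiCurves.heightsDims_eq {F : Type*} [Field F] {K K' : Complex d} {s : Dir d}
    (h : SameBettiCurves F K K' s) : heightsDims K s = heightsDims K' s := by
  obtain ⟨I, I', hI⟩ := h
  refine heightsDims_eq_of_cumulative fun k p => ?_
  have h1 := I.two_mul_card_filter F k p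
  have h2 := I'.two_mul_card_filter F k p
  rw [hI k, hI (k - 1), ← h2] at h1
  omega

end DirectionalTransform

end

/-! ### The query bound and faithfulness -/

theorem mainTheorem8 :
    ∃ C : ℕ, ∀ (d : ℕ) [NeZero d], 2 ≤ d →
      ∀ pick : Set (DirectionalTransform.Dir d) → DirectionalTransform.Dir d,
      (∀ A : Set (DirectionalTransform.Dir d), A.Nonempty → pick A ∈ A) →
      ∀ K : DirectionalTransform.Complex d,
      DirectionalTransform.GeneralPosition K.verts → K.dim < d →
      ∀ S : List (DirectionalTransform.Dir d),
      S = (DirectionalTransform.reconstruct pick).queries (DirectionalTransform.heightsDims K) →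
      S.length ≤ C * (d + 2 ^ K.dim * K.simplices.card * K.verts.card) ∧
      (∀ (F : Type*) [Field F] (K' : DirectionalTransform.Complex d),
        (∀ s ∈ S, DirectionalTransform.SameBettiCurves F K K' s) → K' = K) ∧
      (∀ (X : Type*) (T : DirectionalTransform.Complex d → DirectionalTransform.Dir d → X),
        DirectionalTransform.IsDimensionReturning T →
        ∀ K' : DirectionalTransform.Complex d, (∀ s ∈ S, T K' s = T K s) → K' = K) := by
  refine ⟨4, ?_⟩
  rintro d _ hd pick hpick K hK hdim S rfl
  refine ⟨DirectionalTransform.reconstruct_length_queries hd hpick hK hdim, ?_, ?_⟩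
  · intro F _ K' h
    exact DirectionalTransform.eq_of_answers hd hpick hK hdim fun s hs =>
      (h s hs).heightsDims_eq.symm
  · rintro X T ⟨read, hread⟩ K' h
    refine DirectionalTransform.eq_of_answers hd hpick hK hdim fun s hs => ?_
    rw [← hread, ← hread, h s hs]
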